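/- Let $Z$ and $T$ be measurable spaces carrying probability distributions $F(z)$ (data) and $F(\tau)$ (subjects), and let $Q(z,\tau,\alpha)$, $\alpha\in\Lambda$, be a measurable set of loss functions: each $Q(\cdot,\cdot,\alpha)$ is jointly measurable and, up to null sets, the suprema over $\alpha\in\Lambda$ of finite weighted sums $\sum_i w_i Q(z_i,\tau,\alpha)$ and $\sum_j w_j R^{lo}(\tau_j,\alpha)$ are measurable in the sample points, where $R^{lo}(\tau,\alpha)=\int Q(z,\tau,\alpha)\,dF(z)$. Assume $A_z\le Q(z,\tau,\alpha)\le B_z$ and $A_\tau\le R^{lo}(\tau,\alpha)\le B_\tau$ for all $z,\tau,\alpha$, with $A_\tau<B_\tau$. Let $z_1,z_2,\dots$ be i.i.d. with law $F(z)$ and $\tau_1,\tau_2,\dots$ i.i.d. with law $F(\tau)$, the two sequences being independent of each other, and put $$R(\alpha)=\iint Q\,dF(z)\,dF(\tau),\qquad R_{emp}(\alpha,m,l)=\frac1m\sum_{j=1}^m\frac1l\sum_{i=1}^l Q(z_i,\tau_j,\alpha).$$ For fixed $\tau$ let $N_z(z_1,\dots,z_l)$ be the number of different separations of $z_1,\dots,z_l$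 by the indicators $\theta\{Q(z,\tau,\alpha)-\beta\}$, $\alpha\in\Lambda$, $\inf Q\le\beta\le\sup Q$, where $\theta(u)=1$ for $u\ge0$ and $\theta(u)=0$ for $u<0$. Let $N_\tau(\tau_1,\dots,\tau_m)$ be the number of different separations of $\tau_1,\dots,\tau_m$ by the indicators $\theta\{R^{lo}(\tau,\alpha)-\beta\}$, $\alpha\in\Lambda$, $\inf R^{lo}\le\beta\le\sup R^{lo}$. Assume that $N_z$ (for almost every $\tau$) and $N_\tau$ are measurable functions of the sample, and let $\hat H_z(l)=\ln \mathbb{E} N_z(z_1,\dots,z_l)$ (which depends on $\tau$) and $\hat H_\tau(m)=\ln \mathbb{E} N_\tau(\tau_1,\dots,\tau_m)$ be the annealed entropies. **Corollary (Sufficient conditions of consistency).** Suppose that $$\lim_{l\to\infty}\frac{\hat H_z(l)}{l}=0\ \text{ for almost every }\tau,\qquad \lim_{m\to\infty}\frac{\hat H_\tau(m)}{m}=0,$$ and that, for some fixed $\varepsilon_0>0$, the numbers of samples obey the rule $$l>\frac{2(B_z-A_z)^2}{\varepsilon_0^2}\ln m+\frac{(B_z-A_z)^2}{(B_\tau-A_\tau)^2}\,m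 .\tag{$*$}$$ Then: 1. (Non-trivial exponential bounds.) For every $\varepsilon>0$ there is a rate $c>0$, depending only on $\varepsilon,\varepsilon_0,A_z,B_z,A_\tau,B_\tau$, and there is a number $M$ such that for all $m\ge M$ and all $l$ satisfying $(*)$, $$P\Big\{\sup_{\alpha\in\Lambda}\big(R(\alpha)-R_{emp}(\alpha,m,l)\big)>\varepsilon\Big\}\le 4e^{-cm}+4e^{-cl}.$$ 2. (One-sided uniform convergence.) For every $\varepsilon>0$ the probability on the left tends to $0$ as $m,l\to\infty$ subject to $(*)$. 3. (Strict consistency of empirical global risk minimization.) For every $c\in\mathbb{R}$ for which $\Lambda(c)=\{\alpha: R(\alpha)\ge c\}$ is nonempty, $\inf_{\alpha\in\Lambda(c)}R_{emp}(\alpha,m,l)\to\inf_{\alpha\in\Lambda(c)}R(\alpha)$ in probability as $m,l\to\infty$ subject to $(*)$. (For a possibly non-measurable event, $P$ denotes outer probability.) -/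

import Mathlib

open MeasureTheory ProbabilityTheory Filter Topology

noncomputable section

namespace SubjectivityLearning

/-! Throughout, `Q z t a` is the basic loss of the data vector `z` under the subject `t` for the
parameter `a`; `μ` is the distribution of data and `ν` the distribution of subjects. -/

section Risk

variable {Z T Λ Ω : Type*} [MeasurableSpace Z] [MeasurableSpace T]

/-- The local risk `R^lo(t, a) = ∫ Q(z, t, a) dF(z)`. -/
def localRisk (μ : Measure Z) (Q : Z → T → Λ → ℝ) (a : Λ) (t : T) : ℝ :=
  ∫ z, Q z t a ∂μ

/-- The global risk `R(a) = ∬ Q(z, t, a) dF(z) dF(t)`. -/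
def globalRisk (μ : Measure Z) (ν : Measure T) (Q : Z → T → Λ → ℝ) (a : Λ) : ℝ :=
  ∫ t, ∫ z, Q z t a ∂μ ∂ν

/-- The empirical global risk built from the first `m` subjects and the first `l` data. -/
def empRisk (Q : Z → T → Λ → ℝ) (zs : ℕ → Ω → Z) (ts : ℕ → Ω → T)
    (m l : ℕ) (a : Λ) (ω : Ω) : ℝ :=
  (1 / (m : ℝ)) * ∑ j ∈ Finset.range m,
    (1 / (l : ℝ)) * ∑ i ∈ Finset.range l, Q (zs i ω) (ts j ω) a

/-- The one-sided empirical process `ξ^⟨m,l⟩ = sup_a (R(a) - R_emp(a, m, l))`. -/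
def oneSidedProcess (μ : Measure Z) (ν : Measure T) (Q : Z → T → Λ → ℝ)
    (zs : ℕ → Ω → Z) (ts : ℕ → Ω → T) (m l : ℕ) (ω : Ω) : ℝ :=
  ⨆ a : Λ, (globalRisk μ ν Q a - empRisk Q zs ts m l a ω)

/-- The set `Λ(c)` of parameters whose global risk is at least `c`. -/
def riskSuperlevel (μ : Measure Z) (ν : Measure T) (Q : Z → T → Λ → ℝ) (c : ℝ) : Set Λ :=
  {a | c ≤ globalRisk μ ν Q a}

/-- One-sided uniform convergence when the pair `(m, l)` tends to infinity along `L`. -/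
def OneSidedUniformConvergence [MeasurableSpace Ω] (P : Measure Ω) (μ : Measure Z)
    (ν : Measure T) (Q : Z → T → Λ → ℝ) (zs : ℕ → Ω → Z) (ts : ℕ → Ω → T)
    (L : Filter (ℕ × ℕ)) : Prop :=
  ∀ ε : ℝ, 0 < ε →
    Tendsto (fun p : ℕ × ℕ => P {ω | ε < oneSidedProcess μ ν Q zs ts p.1 p.2 ω}) L (𝓝 0)

/-- Strict (nontrivial) consistency of empirical global risk minimization when the pair `(m, l)`
tends to infinity along `L`: for every nonempty `Λ(c)`, the infimum over `Λ(c)` of the empirical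
global risk converges in probability to the infimum over `Λ(c)` of the global risk. -/
def StrictlyConsistent [MeasurableSpace Ω] (P : Measure Ω) (μ : Measure Z)
    (ν : Measure T) (Q : Z → T → Λ → ℝ) (zs : ℕ → Ω → Z) (ts : ℕ → Ω → T)
    (L : Filter (ℕ × ℕ)) : Prop :=
  ∀ c : ℝ, (riskSuperlevel μ ν Q c).Nonempty →
    TendstoInMeasure P
      (fun (p : ℕ × ℕ) ω => ⨅ a : riskSuperlevel μ ν Q c, empRisk Q zs ts p.1 p.2 a ω) L
      (fun _ => ⨅ a : riskSuperlevel μ ν Q c, globalRisk μ ν Q a)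

end Risk

section SampleRule

/-- The relation between the number `m` of subjects and the number `l` of data. -/
def SampleRule (Az Bz At Bt ε : ℝ) (m l : ℕ) : Prop :=
  (l : ℝ) > 2 * (Bz - Az) ^ 2 / ε ^ 2 * Real.log m + (Bz - Az) ^ 2 / (Bt - At) ^ 2 * m

/-- `⟨m, l⟩ → ∞`: both numbers tend to infinity while obeying the sample-size relation. -/
def sampleFilter (Az Bz At Bt ε : ℝ) : Filter (ℕ × ℕ) :=
  atTop ⊓ 𝓟 {p | SampleRule Az Bz At Bt ε p.1 p.2}

end SampleRule

section Entropy

variable {X Λ : Type*}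

/-- The separations of the points `x 0, …, x (n-1)` by the indicators `θ(f a · - β)`, where
`a : Λ`, `β ∈ B`, and `θ(u) = 1` for `u ≥ 0`, `θ(u) = 0` for `u < 0`. A separation is recorded as
the set of indices at which the indicator is `1`. -/
def separations (f : Λ → X → ℝ) (B : Set ℝ) {n : ℕ} (x : Fin n → X) : Set (Set (Fin n)) :=
  {s | ∃ a : Λ, ∃ β ∈ B, s = {i | 0 ≤ f a (x i) - β}}

/-- The number of different separations. -/
def numSeparations (f : Λ → X → ℝ) (B : Set ℝ) {n : ℕ} (x : Fin n → X) : ℕ :=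
  (separations f B x).ncard

/-- The annealed entropy `ln E N(x_1, …, x_n)` for independent points with law `ρ`. -/
def annealedEntropy [MeasurableSpace X] (ρ : Measure X) (f : Λ → X → ℝ) (B : Set ℝ) (n : ℕ) : ℝ :=
  Real.log (∫ x, (numSeparations f B x : ℝ) ∂(Measure.pi fun _ : Fin n => ρ))

variable {Z T : Type*} [MeasurableSpace Z] [MeasurableSpace T]

/-- The admissible thresholds for the loss: `[inf Q, sup Q]`. -/
def dataThresholds (Q : Z → T → Λ → ℝ) : Set ℝ :=
  Set.Icc (⨅ p : Z × T × Λ, Q p.1 p.2.1 p.2.2) (⨆ p : Z × T × Λ, Q p.1 p.2.1 p.2.2)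

/-- The admissible thresholds for the local risk: `[inf R^lo, sup R^lo]`. -/
def subjectThresholds (μ : Measure Z) (Q : Z → T → Λ → ℝ) : Set ℝ :=
  Set.Icc (⨅ p : Λ × T, localRisk μ Q p.1 p.2) (⨆ p : Λ × T, localRisk μ Q p.1 p.2)

/-- `N_z` for the specific subject `t`. -/
def dataSeparations (Q : Z → T → Λ → ℝ) (t : T) {l : ℕ} (z : Fin l → Z) : ℕ :=
  numSeparations (fun a z => Q z t a) (dataThresholds Q) z

/-- `N_t`, the number of separations of subjects by the local risks. -/
def subjectSeparations (μ : Measure Z) (Q : Z → T → Λ → ℝ) {m : ℕ} (t : Fin m → T) : ℕ :=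
  numSeparations (localRisk μ Q) (subjectThresholds μ Q) t

/-- The annealed entropy of data risk under the specific subject `t`. -/
def dataEntropy (μ : Measure Z) (Q : Z → T → Λ → ℝ) (t : T) (l : ℕ) : ℝ :=
  annealedEntropy μ (fun a z => Q z t a) (dataThresholds Q) l

/-- The annealed entropy of subjectivity risk. -/
def subjectEntropy (μ : Measure Z) (ν : Measure T) (Q : Z → T → Λ → ℝ) (m : ℕ) : ℝ :=
  annealedEntropy ν (localRisk μ Q) (subjectThresholds μ Q) m

/-- The losses and the local risks form measurable sets of functions: every function is
measurable, and so are (up to null sets) the suprema over the set of weighted sums of function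
values at independent sample points. Countable and pointwise separable sets of measurable functions
have this property. -/
structure IsMeasurableSet (μ : Measure Z) (ν : Measure T) (Q : Z → T → Λ → ℝ) : Prop where
  measurable : ∀ a, Measurable fun p : Z × T => Q p.1 p.2 a
  sup_data : ∀ (n : ℕ) (w : Fin n → ℝ),
    AEMeasurable (fun p : (Fin n → Z) × T => ⨆ a, ∑ i, w i * Q (p.1 i) p.2 a)
      ((Measure.pi fun _ : Fin n => μ).prod ν)
  sup_subject : ∀ (n : ℕ) (w : Fin n → ℝ),
    AEMeasurable (fun t : Fin n → T => ⨆ a, ∑ j, w j * localRisk μ Q a (t j))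
      (Measure.pi fun _ : Fin n => ν)

end Entropy

end SubjectivityLearning

end

noncomputable section

namespace SubjectivityLearning

/-! ### Deterministic tools: thresholds and sign counts. -/

section Finite

/-! The gap R(α) − R_emp(α) is the gap over subjects for the local risk plus the mean, over the
sampled subjects, of the gaps over data (`globalRisk_sub_empRisk`). Both are controlled uniformly in
α by the Vapnik–Chervonenkis argument. A ghost sample replaces the true mean by a second sample mean
at the cost of a factor 2. Exchanging members of the pairs preserves the law, so on a fixed double
sample it suffices to count the exchanges that produce a large difference of half-means. The weights
of this difference sum to zero, so it is an integral over thresholds of the same difference for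
indicators (`exists_threshold`). Hence only the finitely many separations matter (`card_swaps_le`),
each with a Rademacher tail (`card_signs_le`). Integration gives the expected number of separations
times an exponentially small factor (`measure_split_le`), and a vanishing entropy rate makes the
former subexponential.

The data part has two further difficulties. The entropy condition holds subject by subject, with no
common speed. As in Egorov's theorem, a set of subjects of measure close to 1 admits a common
sample-size threshold (`exists_good_subjects`). By Hoeffding the remaining subjects are a small
fraction of the sample, and each costs at most the range K (`mean_le_of_few_bad`). Moreover, all
subjects share the same data, so their gaps are dependent. A union bound costs a factor m, which the
exponential in l absorbs because (∗) makes l grow at least linearly in m. This fails only for a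
constant loss, where there is no gap.

Strict consistency needs the uniform bound on one side only. On the other side the deviation at a
single near-minimizer is enough (`measure_empRisk_sub_le`). -/

open scoped Classical in
lemma intervalIntegral_threshold {A B y : ℝ} (hA : A ≤ y) (hB : y ≤ B) :
    IntervalIntegrable (fun β => if 0 ≤ y - β then (1 : ℝ) else 0) volume A B ∧
      ∫ β in A..B, (if 0 ≤ y - β then (1 : ℝ) else 0) = y - A := by
  have h : (fun β : ℝ => if 0 ≤ y - β then (1 : ℝ) else 0) = (Set.Iic y).indicator 1 := by
    ext β
    simp [Set.indicator_apply, sub_nonneg]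
  rw [h]
  constructor
  · rw [intervalIntegrable_iff]
    exact (show IntegrableOn (fun _ : ℝ => (1 : ℝ)) (Set.uIoc A B) from
      integrableOn_const (by simp [Set.uIoc])).indicator measurableSet_Iic
  · rw [intervalIntegral.integral_of_le (hA.trans hB), integral_indicator_one measurableSet_Iic,
      measureReal_restrict_apply measurableSet_Iic, Set.Iic_inter_Ioc_of_le hB]
    simp [hA]

/-- A weighted sum with weights of total mass zero is an average over the thresholds. -/
lemma exists_threshold {ι : Type*} [Fintype ι] {w y : ι → ℝ} {A B K δ : ℝ}
    (hA : ∀ i, A ≤ y i) (hB : ∀ i, y i ≤ B) (hAB : A ≤ B) (hw : ∑ i, w i = 0)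
    (hK : B - A ≤ K) (hK0 : 0 < K) (hδ : 0 ≤ δ) (h : δ < ∑ i, w i * y i) :
    ∃ β ∈ Set.Icc A B, δ / K < ∑ i, w i * (if 0 ≤ y i - β then (1 : ℝ) else 0) := by
  by_contra! hcon
  -- Zero total weight allows subtracting A, and `y i - A` is the integral over [A, B] of the
  -- indicator of `β ≤ y i`.
  have h1 : ∑ i, w i * y i = ∑ i, w i * (y i - A) := by
    simp [mul_sub, Finset.sum_sub_distrib, ← Finset.sum_mul, hw]
  have hint : ∀ i ∈ Finset.univ, IntervalIntegrable
      (fun β => w i * (if 0 ≤ y i - β then (1 : ℝ) else 0)) volume A B := fun i _ =>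
    (intervalIntegral_threshold (hA i) (hB i)).1.const_mul _
  have h2 : ∑ i, w i * (y i - A) =
      ∫ β in A..B, ∑ i, w i * (if 0 ≤ y i - β then (1 : ℝ) else 0) := by
    rw [intervalIntegral.integral_finsetSum hint]
    refine Finset.sum_congr rfl fun i _ => ?_
    rw [intervalIntegral.integral_const_mul, (intervalIntegral_threshold (hA i) (hB i)).2]
  have h3 : ∫ β in A..B, ∑ i, w i * (if 0 ≤ y i - β then (1 : ℝ) else 0) ≤
      ∫ _ in A..B, δ / K := by
    refine intervalIntegral.integral_mono_on hAB ?_ (by simp) hcon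
    simpa [Finset.sum_fn] using IntervalIntegrable.sum (Finset.univ) hint
  rw [intervalIntegral.integral_const, smul_eq_mul] at h3
  have h4 : (B - A) * (δ / K) ≤ δ := by
    rw [mul_div_assoc', div_le_iff₀ hK0]
    nlinarith
  linarith

/-- The tail of a Rademacher sum, as a count of sign patterns. -/
lemma card_signs_le {n : ℕ} {v : Fin n → ℝ} (hv : ∀ i, |v i| ≤ 1) {t : ℝ} (ht : 0 ≤ t) :
    (Finset.card {σ : Fin n → Bool | t * n < ∑ i, (if σ i then v i else -v i)} : ℝ) ≤
      2 ^ n * Real.exp (-(t ^ 2 * n / 2)) := by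
  -- Chernoff's method with exponential parameter t, the minimizer of `s ^ 2 * n / 2 - s * t * n`
  -- over s.
  have hmgf : ∑ σ : Fin n → Bool, Real.exp (t * ∑ i, (if σ i then v i else -v i)) ≤
      2 ^ n * Real.exp (t ^ 2 * n / 2) := by
    calc ∑ σ : Fin n → Bool, Real.exp (t * ∑ i, (if σ i then v i else -v i))
        = ∑ σ : Fin n → Bool, ∏ i, Real.exp (t * (if σ i then v i else -v i)) := by
          refine Finset.sum_congr rfl fun σ _ => ?_
          rw [Finset.mul_sum, Real.exp_sum]
      _ = ∏ i, ∑ b : Bool, Real.exp (t * (if b then v i else -v i)) := by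
          rw [Finset.prod_univ_sum, Fintype.piFinset_univ]
      _ ≤ ∏ _i : Fin n, (2 * Real.exp (t ^ 2 / 2)) := by
          refine Finset.prod_le_prod (fun i _ => by positivity) fun i _ => ?_
          have h1 : ∑ b : Bool, Real.exp (t * (if b then v i else -v i)) =
              2 * Real.cosh (t * v i) := by
            simp [Real.cosh_eq]
            ring
          rw [h1]
          have h2 : (t * v i) ^ 2 ≤ t ^ 2 := by
            have : (v i) ^ 2 ≤ 1 := (sq_le_one_iff_abs_le_one _).2 (hv i)
            nlinarith [sq_nonneg t]
          have h3 := Real.cosh_le_exp_half_sq (t * v i)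
          have h4 : Real.exp ((t * v i) ^ 2 / 2) ≤ Real.exp (t ^ 2 / 2) := by gcongr
          linarith
      _ = 2 ^ n * Real.exp (t ^ 2 * n / 2) := by
          rw [Finset.prod_const, mul_pow, ← Real.exp_nat_mul]
          simp
          ring_nf
  have hle : (Finset.card {σ : Fin n → Bool | t * n < ∑ i, (if σ i then v i else -v i)} : ℝ) *
      Real.exp (t * (t * n)) ≤
      ∑ σ : Fin n → Bool, Real.exp (t * ∑ i, (if σ i then v i else -v i)) := by
    rw [← nsmul_eq_mul, ← Finset.sum_const]
    refine (Finset.sum_le_sum (f := fun _ => Real.exp (t * (t * n)))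
      (g := fun σ : Fin n → Bool => Real.exp (t * ∑ i, (if σ i then v i else -v i))) ?_).trans
      (Finset.sum_le_univ_sum_of_nonneg fun _ => (Real.exp_pos _).le)
    intro σ hσ
    have := (Finset.mem_filter.1 hσ).2
    gcongr
  have hexp : Real.exp (t ^ 2 * n / 2) = Real.exp (-(t ^ 2 * n / 2)) * Real.exp (t * (t * n)) := by
    rw [← Real.exp_add]
    ring_nf
  have h := hle.trans hmgf
  rw [hexp, ← mul_assoc (2 ^ n)] at h
  exact le_of_mul_le_mul_right h (Real.exp_pos _)

end Finite

/-! ### Hoeffding's inequality on product spaces. -/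

section Product

variable {X : Type*} [MeasurableSpace X]

/-- Hoeffding's inequality for the coordinates of a product space. -/
lemma pi_hoeffding (ρ : Measure X) [IsProbabilityMeasure ρ] {g : X → ℝ} (hg : Measurable g)
    {A B K : ℝ} (hA : ∀ x, A ≤ g x) (hB : ∀ x, g x ≤ B) (hK : B - A ≤ K) (hK0 : 0 < K)
    {ε : ℝ} (hε : 0 ≤ ε) (n : ℕ) :
    (Measure.pi fun _ : Fin n => ρ) {x | ε * n ≤ ∑ i, (g (x i) - ∫ y, g y ∂ρ)} ≤
      ENNReal.ofReal (Real.exp (-(2 * ε ^ 2 * n / K ^ 2))) := by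
  rcases Nat.eq_zero_or_pos n with rfl | hn
  · simp
  have hind : iIndepFun (fun (i : Fin n) (x : Fin n → X) => g (x i) - ∫ y, g y ∂ρ)
      (Measure.pi fun _ : Fin n => ρ) :=
    iIndepFun_pi (μ := fun _ : Fin n => ρ) (X := fun _ y => g y - ∫ y, g y ∂ρ)
      fun _ => (hg.sub_const _).aemeasurable
  -- The enclosing interval is [A, A + K] rather than [A, B], so the variance proxy is K²/4 and
  -- stays positive even for a constant g.
  have hsub : ∀ i ∈ (Finset.univ : Finset (Fin n)),
      HasSubgaussianMGF (fun x : Fin n → X => g (x i) - ∫ y, g y ∂ρ) ((‖A + K - A‖₊ / 2) ^ 2)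
        (Measure.pi fun _ : Fin n => ρ) := by
    intro i _
    have h := hasSubgaussianMGF_of_mem_Icc (μ := Measure.pi fun _ : Fin n => ρ)
      (X := fun x : Fin n → X => g (x i)) (a := A) (b := A + K)
      (hg.comp (measurable_pi_apply i)).aemeasurable (ae_of_all _ fun x => ⟨hA _, by linarith [hB (x i)]⟩)
    have hi : ∫ x : Fin n → X, g (x i) ∂(Measure.pi fun _ : Fin n => ρ) = ∫ y, g y ∂ρ :=
      integral_comp_eval (μ := fun _ : Fin n => ρ) (i := i) hg.aestronglyMeasurable
    rwa [hi] at h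
  have h := HasSubgaussianMGF.measure_sum_ge_le_of_iIndepFun hind hsub
    (ε := ε * n) (by positivity)
  rw [← ofReal_measureReal]
  refine ENNReal.ofReal_le_ofReal (h.trans ?_)
  refine Real.exp_le_exp.2 ?_
  have hn' : (0 : ℝ) < n := by exact_mod_cast hn
  simp only [Finset.sum_const, Finset.card_univ, Fintype.card_fin, nsmul_eq_mul]
  push_cast
  rw [add_sub_cancel_left, Real.norm_of_nonneg hK0.le]
  refine le_of_eq ?_
  field_simp

end Product

/-! ### Symmetrization: double samples, exchanges and ghost samples. -/

section Symmetrization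

variable {X Λ : Type*}

/-- The weights computing the mean over the second half minus the mean over the first half. -/
def splitWeights (n : ℕ) : Fin (n + n) → ℝ :=
  Fin.append (fun _ => -(1 / (n : ℝ))) (fun _ => 1 / (n : ℝ))

lemma sum_splitWeights_mul (n : ℕ) (y : Fin (n + n) → ℝ) :
    ∑ k, splitWeights n k * y k =
      1 / (n : ℝ) * ∑ i, (y (Fin.natAdd n i) - y (Fin.castAdd n i)) := by
  rw [Fin.sum_univ_add]
  simp only [splitWeights, Fin.append_left, Fin.append_right, Finset.sum_sub_distrib, mul_sub,
    ← Finset.mul_sum]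
  ring

lemma sum_splitWeights (n : ℕ) : ∑ k, splitWeights n k = 0 := by
  simpa using sum_splitWeights_mul n (fun _ => 1)

/-- The double sample built from a sample of pairs. -/
def appendPairs {n : ℕ} (w : Fin n → X × X) : Fin (n + n) → X :=
  Fin.append (fun i => (w i).1) (fun i => (w i).2)

/-- Exchange the two members of the pairs marked `false`. -/
def swapPairs {n : ℕ} (σ : Fin n → Bool) (w : Fin n → X × X) : Fin n → X × X :=
  fun i => if σ i then w i else (w i).swap

lemma finite_separations (f : Λ → X → ℝ) (B : Set ℝ) {n : ℕ} (x : Fin n → X) :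
    (separations f B x).Finite := Set.toFinite _

lemma numSeparations_le (f : Λ → X → ℝ) (B : Set ℝ) {n : ℕ} (x : Fin n → X) :
    numSeparations f B x ≤ 2 ^ n := by
  refine (Set.ncard_le_ncard (Set.subset_univ _) Set.finite_univ).trans_eq ?_
  rw [Set.ncard_univ, Nat.card_eq_fintype_card]
  simp

lemma one_le_numSeparations [Nonempty Λ] (f : Λ → X → ℝ) {B : Set ℝ} (hB : B.Nonempty) {n : ℕ}
    (x : Fin n → X) : 1 ≤ numSeparations f B x := by
  obtain ⟨β, hβ⟩ := hB
  obtain ⟨a⟩ := ‹Nonempty Λ›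
  exact (Set.ncard_pos (finite_separations f B x)).2 ⟨_, a, β, hβ, rfl⟩

/-- A real supremum of an unbounded family is 0 by convention. Boundedness is what lets a deviation
of the supremum be traded for a deviation at some parameter, and conversely. -/
lemma bddAbove_weighted {f : Λ → X → ℝ} {A B : ℝ} (hA : ∀ a x, A ≤ f a x)
    (hB : ∀ a x, f a x ≤ B) {n : ℕ} (w : Fin n → ℝ) (x : Fin n → X) :
    BddAbove (Set.range fun a => ∑ k, w k * f a (x k)) := by
  refine ⟨∑ k, |w k| * (|A| + |B|), ?_⟩
  rintro _ ⟨a, rfl⟩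
  refine Finset.sum_le_sum fun k _ => ?_
  refine (le_abs_self _).trans ?_
  rw [abs_mul]
  refine mul_le_mul_of_nonneg_left ?_ (abs_nonneg _)
  rw [abs_le]
  constructor
  · linarith [hA a (x k), neg_abs_le A, abs_nonneg B]
  · linarith [hB a (x k), le_abs_self B, abs_nonneg A]

open scoped Classical in
/-- Few exchanges of a double sample produce a large deviation between the two halves. -/
lemma card_swaps_le {f : Λ → X → ℝ} {A B K δ : ℝ} (hA : ∀ a x, A ≤ f a x)
    (hB : ∀ a x, f a x ≤ B) (hAB : A ≤ B) (hK : B - A ≤ K) (hK0 : 0 < K) (hδ : 0 ≤ δ) {n : ℕ}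
    (hn : 0 < n) (w : Fin n → X × X) :
    (Finset.card {σ : Fin n → Bool | ∃ a,
      δ < ∑ k, splitWeights n k * f a (appendPairs (swapPairs σ w) k)} : ℝ) ≤
      2 ^ n * Real.exp (-(δ ^ 2 * n / (2 * K ^ 2))) *
        numSeparations f (Set.Icc A B) (appendPairs w) := by
  have hn' : (0 : ℝ) < n := by exact_mod_cast hn
  set F := (finite_separations f (Set.Icc A B) (appendPairs w)).toFinset with hF
  -- The contribution of pair i to the difference of the halves under the separation s. Exchanging
  -- the pair flips its sign, so the separations of the unexchanged sample describe every exchange.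
  let v : Set (Fin (n + n)) → Fin n → ℝ := fun s i =>
    (if Fin.natAdd n i ∈ s then (1 : ℝ) else 0) - (if Fin.castAdd n i ∈ s then (1 : ℝ) else 0)
  have hv : ∀ s i, |v s i| ≤ 1 := by
    intro s i
    simp only [v]
    split_ifs <;> norm_num
  -- The threshold β depends on σ and a, but it enters only through the separation it induces. A
  -- union over separations therefore replaces the union over all a and β.
  have hsub : (Finset.univ.filter fun σ : Fin n → Bool => ∃ a,
      δ < ∑ k, splitWeights n k * f a (appendPairs (swapPairs σ w) k)) ⊆
      F.biUnion fun s => Finset.univ.filter fun σ : Fin n → Bool =>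
        δ / K * n < ∑ i, (if σ i then v s i else -v s i) := by
    intro σ hσ
    obtain ⟨a, ha⟩ := (Finset.mem_filter.1 hσ).2
    obtain ⟨β, hβ, hlt⟩ := exists_threshold (fun k => hA a _) (fun k => hB a _) hAB
      (sum_splitWeights n) hK hK0 hδ ha
    refine Finset.mem_biUnion.2 ⟨{k | 0 ≤ f a (appendPairs w k) - β}, ?_, ?_⟩
    · rw [hF, Set.Finite.mem_toFinset]
      exact ⟨a, β, hβ, rfl⟩
    · refine Finset.mem_filter.2 ⟨Finset.mem_univ _, ?_⟩
      rw [sum_splitWeights_mul, one_div, ← div_eq_inv_mul, lt_div_iff₀ hn'] at hlt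
      refine hlt.trans_eq (Finset.sum_congr rfl fun i _ => ?_)
      cases h : σ i <;> simp [v, appendPairs, swapPairs, h, -Fin.natAdd_eq_addNat]
  have hcard : ∀ s ∈ F, (Finset.card (Finset.univ.filter fun σ : Fin n → Bool =>
        δ / K * n < ∑ i, (if σ i then v s i else -v s i)) : ℝ) ≤
      2 ^ n * Real.exp (-(δ ^ 2 * n / (2 * K ^ 2))) := by
    intro s _
    refine (card_signs_le (hv s) (by positivity)).trans_eq ?_
    congr 3
    field_simp
  calc (Finset.card {σ : Fin n → Bool | ∃ a,
        δ < ∑ k, splitWeights n k * f a (appendPairs (swapPairs σ w) k)} : ℝ)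
      ≤ ∑ s ∈ F, (Finset.card (Finset.univ.filter fun σ : Fin n → Bool =>
        δ / K * n < ∑ i, (if σ i then v s i else -v s i)) : ℝ) := by
        exact_mod_cast (Finset.card_le_card hsub).trans Finset.card_biUnion_le
    _ ≤ ∑ _s ∈ F, 2 ^ n * Real.exp (-(δ ^ 2 * n / (2 * K ^ 2))) := Finset.sum_le_sum hcard
    _ = _ := by
        rw [Finset.sum_const, nsmul_eq_mul, mul_comm, numSeparations,
          Set.ncard_eq_toFinset_card _ (finite_separations f (Set.Icc A B) (appendPairs w))]

variable [MeasurableSpace X]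

lemma measurable_append {n : ℕ} :
    Measurable fun p : (Fin n → X) × (Fin n → X) => Fin.append p.1 p.2 := by
  refine measurable_pi_iff.2 fun k => ?_
  refine Fin.addCases (fun i => ?_) (fun i => ?_) k
  · simp only [Fin.append_left]; fun_prop
  · simp only [Fin.append_right]; fun_prop

/-- The double sample is viewed as n independent pairs, the form on which exchanges act. The
ghost-sample step views it instead as two independent halves, as in `measurePreserving_append`. -/
lemma measurePreserving_appendPairs (ρ : Measure X) [IsProbabilityMeasure ρ] (n : ℕ) :
    MeasurePreserving (appendPairs (X := X) (n := n)) (Measure.pi fun _ => ρ.prod ρ)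
      (Measure.pi fun _ => ρ) := by
  have hm : Measurable (appendPairs (X := X) (n := n)) :=
    measurable_append.comp (f := fun w : Fin n → X × X => (fun i => (w i).1, fun i => (w i).2))
      (by fun_prop)
  refine ⟨hm, (Measure.pi_eq fun s hs => ?_).symm⟩
  rw [Measure.map_apply hm (MeasurableSet.univ_pi hs)]
  have h : appendPairs ⁻¹' (Set.pi Set.univ s) =
      Set.pi Set.univ fun i : Fin n => s (Fin.castAdd n i) ×ˢ s (Fin.natAdd n i) := by
    ext w
    simp only [Set.mem_preimage, Set.mem_univ_pi, Set.mem_prod, appendPairs]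
    rw [Fin.forall_fin_add]
    simp [forall_and, -Fin.natAdd_eq_addNat]
  rw [h, Measure.pi_pi]
  simp [Measure.prod_prod, Fin.prod_univ_add, Finset.prod_mul_distrib]

lemma measurePreserving_append (ρ : Measure X) [IsProbabilityMeasure ρ] (n : ℕ) :
    MeasurePreserving (fun p : (Fin n → X) × (Fin n → X) => Fin.append p.1 p.2)
      ((Measure.pi fun _ => ρ).prod (Measure.pi fun _ => ρ)) (Measure.pi fun _ => ρ) := by
  refine ⟨measurable_append, (Measure.pi_eq fun s hs => ?_).symm⟩
  rw [Measure.map_apply measurable_append (MeasurableSet.univ_pi hs)]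
  have h : (fun p : (Fin n → X) × (Fin n → X) => Fin.append p.1 p.2) ⁻¹' (Set.pi Set.univ s) =
      (Set.pi Set.univ fun i : Fin n => s (Fin.castAdd n i)) ×ˢ
        (Set.pi Set.univ fun i : Fin n => s (Fin.natAdd n i)) := by
    ext w
    simp only [Set.mem_preimage, Set.mem_univ_pi, Set.mem_prod]
    rw [Fin.forall_fin_add]
    simp [-Fin.natAdd_eq_addNat]
  rw [h, Measure.prod_prod, Measure.pi_pi, Measure.pi_pi, Fin.prod_univ_add]

lemma measurePreserving_swapPairs (ρ : Measure X) [IsProbabilityMeasure ρ] {n : ℕ}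
    (σ : Fin n → Bool) :
    MeasurePreserving (swapPairs (X := X) σ) (Measure.pi fun _ => ρ.prod ρ)
      (Measure.pi fun _ => ρ.prod ρ) := by
  refine measurePreserving_pi (f := fun i (p : X × X) => if σ i then p else p.swap) _ _ fun i => ?_
  cases σ i
  · exact Measure.measurePreserving_swap
  · exact MeasurePreserving.id _

lemma integrable_numSeparations {ρ : Measure X} [IsProbabilityMeasure ρ] {f : Λ → X → ℝ}
    {B : Set ℝ} {n : ℕ} (h : AEMeasurable (fun x : Fin n → X => (numSeparations f B x : ℝ))
      (Measure.pi fun _ => ρ)) :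
    Integrable (fun x : Fin n → X => (numSeparations f B x : ℝ)) (Measure.pi fun _ => ρ) :=
  Integrable.of_mem_Icc 0 ((2 ^ n : ℕ) : ℝ) h (ae_of_all _ fun x =>
    ⟨Nat.cast_nonneg _, Nat.cast_le.2 (numSeparations_le f B x)⟩)

/-- There is always at least one separation, so the expectation is at least 1 and the logarithm in
the entropy is a genuine one. -/
lemma integral_numSeparations_eq_exp [Nonempty Λ] {ρ : Measure X} [IsProbabilityMeasure ρ]
    {f : Λ → X → ℝ} {B : Set ℝ} (hB : B.Nonempty) {n : ℕ}
    (h : AEMeasurable (fun x : Fin n → X => (numSeparations f B x : ℝ))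
      (Measure.pi fun _ => ρ)) :
    ∫ x, (numSeparations f B x : ℝ) ∂(Measure.pi fun _ : Fin n => ρ) =
      Real.exp (annealedEntropy ρ f B n) := by
  rw [annealedEntropy, Real.exp_log]
  have h1 : ∫ _, (1 : ℝ) ∂(Measure.pi fun _ : Fin n => ρ) ≤
      ∫ x, (numSeparations f B x : ℝ) ∂(Measure.pi fun _ : Fin n => ρ) :=
    integral_mono (integrable_const _) (integrable_numSeparations h)
      fun x => Nat.one_le_cast.2 <| one_le_numSeparations f hB x
  simp at h1
  linarith

/-- The symmetrised Vapnik–Chervonenkis bound with the annealed entropy. -/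
lemma measure_split_le [Nonempty Λ] (ρ : Measure X) [IsProbabilityMeasure ρ] {f : Λ → X → ℝ}
    {A B K δ : ℝ} (hA : ∀ a x, A ≤ f a x) (hB : ∀ a x, f a x ≤ B) (hK : B - A ≤ K)
    (hK0 : 0 < K) (hδ : 0 ≤ δ) {n : ℕ} (hn : 0 < n)
    (hS : AEMeasurable (fun x : Fin (n + n) → X => ⨆ a, ∑ k, splitWeights n k * f a (x k))
      (Measure.pi fun _ => ρ))
    (hN : AEMeasurable (fun x : Fin (n + n) → X => (numSeparations f (Set.Icc A B) x : ℝ))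
      (Measure.pi fun _ => ρ)) :
    (Measure.pi fun _ : Fin (n + n) => ρ)
        {x | δ < ⨆ a, ∑ k, splitWeights n k * f a (x k)} ≤
      ENNReal.ofReal (Real.exp (-(δ ^ 2 * n / (2 * K ^ 2))) *
        Real.exp (annealedEntropy ρ f (Set.Icc A B) (n + n))) := by
  classical
  have hAB : A ≤ B := by
    obtain ⟨x⟩ : Nonempty X := nonempty_of_isProbabilityMeasure ρ
    obtain ⟨a⟩ := ‹Nonempty Λ›
    exact (hA a x).trans (hB a x)
  rw [← integral_numSeparations_eq_exp (Set.nonempty_Icc.2 hAB) hN]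
  set S := {x : Fin (n + n) → X | δ < ⨆ a, ∑ k, splitWeights n k * f a (x k)} with hSdef
  set c : ℝ := Real.exp (-(δ ^ 2 * n / (2 * K ^ 2))) with hc
  have hSm : NullMeasurableSet S (Measure.pi fun _ => ρ) := nullMeasurableSet_lt aemeasurable_const hS
  have happ := measurePreserving_appendPairs ρ n
  have hSm' : NullMeasurableSet (appendPairs ⁻¹' S) (Measure.pi fun _ : Fin n => ρ.prod ρ) :=
    hSm.preimage happ.quasiMeasurePreserving
  -- Every exchange preserves the law, so the measure of S is also its average over all 2^n
  -- exchanges; the counting bound applies under the integral.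
  have hσ : ∀ σ : Fin n → Bool, (Measure.pi fun _ : Fin (n + n) => ρ) S =
      ∫⁻ w, (swapPairs σ ⁻¹' (appendPairs ⁻¹' S)).indicator 1 w
        ∂(Measure.pi fun _ : Fin n => ρ.prod ρ) := by
    intro σ
    have hsw := measurePreserving_swapPairs ρ σ
    rw [lintegral_indicator_one₀ (hSm'.preimage hsw.quasiMeasurePreserving),
      hsw.measure_preimage hSm', happ.measure_preimage hSm]
  have hpt : ∀ w : Fin n → X × X,
      ∑ σ : Fin n → Bool, (swapPairs σ ⁻¹' (appendPairs ⁻¹' S)).indicator (1 : (Fin n → X × X) → ENNReal) w ≤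
      ENNReal.ofReal (2 ^ n * c * numSeparations f (Set.Icc A B) (appendPairs w)) := by
    intro w
    have h := card_swaps_le hA hB hAB hK hK0 hδ hn w
    have h1 : ∑ σ : Fin n → Bool,
        (swapPairs σ ⁻¹' (appendPairs ⁻¹' S)).indicator (1 : (Fin n → X × X) → ENNReal) w =
        ((Finset.univ.filter fun σ : Fin n → Bool => ∃ a,
          δ < ∑ k, splitWeights n k * f a (appendPairs (swapPairs σ w) k)).card : ENNReal) := by
      rw [Finset.card_filter]
      push_cast
      refine Finset.sum_congr rfl fun σ _ => ?_
      simp only [Set.indicator_apply, Set.mem_preimage, Pi.one_apply]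
      have : appendPairs (swapPairs σ w) ∈ S ↔ ∃ a,
          δ < ∑ k, splitWeights n k * f a (appendPairs (swapPairs σ w) k) :=
        lt_ciSup_iff (bddAbove_weighted hA hB _ _)
      simp only [this]
    rw [h1, ← ENNReal.ofReal_natCast]
    exact ENNReal.ofReal_le_ofReal h
  have hsum : (2 ^ n : ENNReal) * (Measure.pi fun _ : Fin (n + n) => ρ) S ≤
      ENNReal.ofReal (2 ^ n * (c *
        ∫ x, (numSeparations f (Set.Icc A B) x : ℝ) ∂(Measure.pi fun _ : Fin (n + n) => ρ))) := by
    calc (2 ^ n : ENNReal) * (Measure.pi fun _ : Fin (n + n) => ρ) S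
        = ∑ _σ : Fin n → Bool, (Measure.pi fun _ : Fin (n + n) => ρ) S := by
          simp
      _ = ∑ σ : Fin n → Bool, ∫⁻ w, (swapPairs σ ⁻¹' (appendPairs ⁻¹' S)).indicator 1 w
            ∂(Measure.pi fun _ : Fin n => ρ.prod ρ) := Finset.sum_congr rfl fun σ _ => hσ σ
      _ = ∫⁻ w, ∑ σ : Fin n → Bool, (swapPairs σ ⁻¹' (appendPairs ⁻¹' S)).indicator 1 w
            ∂(Measure.pi fun _ : Fin n => ρ.prod ρ) := by
          rw [lintegral_finsetSum' _ fun σ _ => ?_]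
          exact aemeasurable_const.indicator₀
            (hSm'.preimage (measurePreserving_swapPairs ρ σ).quasiMeasurePreserving)
      _ ≤ ∫⁻ w, ENNReal.ofReal (2 ^ n * c * numSeparations f (Set.Icc A B) (appendPairs w))
            ∂(Measure.pi fun _ : Fin n => ρ.prod ρ) := lintegral_mono hpt
      _ = ∫⁻ x, ENNReal.ofReal (2 ^ n * c * numSeparations f (Set.Icc A B) x)
            ∂(Measure.pi fun _ : Fin (n + n) => ρ) := by
          rw [← happ.map_eq, lintegral_map' ?_ happ.aemeasurable]
          rw [happ.map_eq]
          exact (hN.const_mul _).ennreal_ofReal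
      _ = _ := by
          rw [← ofReal_integral_eq_lintegral_ofReal
            ((integrable_numSeparations hN).const_mul _) (ae_of_all _ fun x => by positivity),
            integral_const_mul, mul_assoc]
  rw [ENNReal.ofReal_mul (by positivity), ENNReal.ofReal_pow (by norm_num),
    ENNReal.ofReal_ofNat] at hsum
  exact (ENNReal.mul_le_mul_iff_right (by simp) (by simp)).1 hsum

/-- Adding an independent ghost sample, Markov's inequality. -/
lemma measure_ghost_le (ρ : Measure X) [IsProbabilityMeasure ρ] {n : ℕ}
    {S : Set (Fin (n + n) → X)} (hS : MeasurableSet S) :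
    (Measure.pi fun _ : Fin n => ρ)
        {x | 1 / 2 ≤ (Measure.pi fun _ : Fin n => ρ) {y | Fin.append x y ∈ S}} ≤
      2 * (Measure.pi fun _ : Fin (n + n) => ρ) S := by
  have happ := measurePreserving_append ρ n
  have hS' := happ.measurable hS
  have h := mul_meas_ge_le_lintegral (μ := Measure.pi fun _ : Fin n => ρ)
    (measurable_measure_prodMk_left (ν := Measure.pi fun _ : Fin n => ρ) hS') (1 / 2)
  rw [← Measure.prod_apply hS', happ.measure_preimage hS.nullMeasurableSet] at h
  calc _ = 2 * (1 / 2 * (Measure.pi fun _ : Fin n => ρ)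
        {x | 1 / 2 ≤ (Measure.pi fun _ : Fin n => ρ) {y | Fin.append x y ∈ S}}) := by
        rw [← mul_assoc, one_div, ENNReal.mul_inv_cancel (by simp) (by simp), one_mul]
    _ ≤ _ := by gcongr; exact h

/-- The ghost sample has a typical mean with probability at least `1/2`. -/
lemma half_le_measure_ghost (ρ : Measure X) [IsProbabilityMeasure ρ] {g : X → ℝ}
    (hg : Measurable g) {A B K : ℝ} (hA : ∀ x, A ≤ g x) (hB : ∀ x, g x ≤ B) (hK : B - A ≤ K)
    (hK0 : 0 < K) {δ : ℝ} (hδ : 0 ≤ δ) {n : ℕ} (hn : 0 < n)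
    (hlarge : Real.exp (-(2 * δ ^ 2 * n / K ^ 2)) ≤ 1 / 2) {x : Fin n → X}
    (hx : 2 * δ < ∫ y, g y ∂ρ - 1 / (n : ℝ) * ∑ i, g (x i)) :
    1 / 2 ≤ (Measure.pi fun _ : Fin n => ρ)
      {y | δ < ∑ k, splitWeights n k * g (Fin.append x y k)} := by
  have hn' : (0 : ℝ) < n := by exact_mod_cast hn
  -- Only a ghost mean that is too low does harm. If it exceeds the true mean minus δ, the original
  -- deficit of 2δ leaves a difference of more than δ between the halves.
  have h := pi_hoeffding ρ hg.neg (A := -B) (B := -A) (fun x => neg_le_neg (hB x))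
    (fun x => neg_le_neg (hA x)) (by linarith) hK0 hδ n
  set D := {y : Fin n → X | δ * n ≤ ∑ i, ((-g) (y i) - ∫ y, (-g) y ∂ρ)} with hD
  have hDm : MeasurableSet D := by
    refine measurableSet_le measurable_const ?_
    have := hg.neg
    fun_prop
  have hD2 : (Measure.pi fun _ : Fin n => ρ) D ≤ 1 / 2 := by
    refine h.trans ((ENNReal.ofReal_le_ofReal hlarge).trans_eq ?_)
    rw [ENNReal.ofReal_div_of_pos (by norm_num)]
    simp
  have hsub : Dᶜ ⊆ {y | δ < ∑ k, splitWeights n k * g (Fin.append x y k)} := by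
    intro y hy
    simp only [hD, Set.mem_compl_iff, Set.mem_ofPred_eq, not_le, Pi.neg_apply,
      integral_neg, Finset.sum_sub_distrib, Finset.sum_neg_distrib, Finset.sum_const,
      Finset.card_univ, Fintype.card_fin, nsmul_eq_mul] at hy
    rw [Set.mem_ofPred_eq, sum_splitWeights_mul]
    simp only [Fin.append_left, Fin.append_right, Finset.sum_sub_distrib]
    have h1 : ∫ y, g y ∂ρ - 1 / (n : ℝ) * ∑ i, g (y i) < δ := by
      rw [one_div, ← div_eq_inv_mul, sub_lt_iff_lt_add, ← sub_lt_iff_lt_add', lt_div_iff₀ hn']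
      linarith
    linarith
  refine le_trans ?_ (measure_mono hsub)
  rw [prob_compl_eq_one_sub hDm]
  refine le_trans (le_of_eq ?_) (tsub_le_tsub_left hD2 1)
  simp

end Symmetrization

/-! ### Uniform one-sided deviation bounds. -/

section OneSidedBounds

variable {X Z T Λ : Type*} [MeasurableSpace X] [MeasurableSpace Z] [MeasurableSpace T]

lemma eventually_exp_neg_le_half {c : ℝ} (hc : 0 < c) :
    ∀ᶠ n : ℕ in atTop, Real.exp (-(c * n)) ≤ 1 / 2 := by
  have h : Tendsto (fun n : ℕ => Real.exp (-(c * n))) atTop (𝓝 0) :=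
    Real.tendsto_exp_neg_atTop_nhds_zero.comp
      (tendsto_natCast_atTop_atTop.const_mul_atTop hc)
  exact h.eventually_le_const (by norm_num)

/-- Symmetrization evaluates the entropy at the doubled sample size, which does not affect sublinear
growth. -/
lemma eventually_double_le {H : ℕ → ℝ} (hH : Tendsto (fun n : ℕ => H n / n) atTop (𝓝 0))
    {η : ℝ} (hη : 0 < η) : ∀ᶠ n : ℕ in atTop, H (n + n) ≤ η * n := by
  have h2 : Tendsto (fun n : ℕ => n + n) atTop atTop :=
    tendsto_atTop_mono (fun n => Nat.le_add_left n n) tendsto_id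
  filter_upwards [(hH.comp h2).eventually_le_const (u := η / 2) (by positivity),
    eventually_gt_atTop 0] with n hn hn0
  have hn' : (0 : ℝ) < n := by exact_mod_cast hn0
  simp only [Function.comp_apply] at hn
  rw [div_le_iff₀ (by push_cast; positivity)] at hn
  push_cast at hn
  linarith

/-- One-sided deviation of sample means, bounded by the annealed entropy. -/
lemma measure_deviation_le [Nonempty Λ] (ρ : Measure X) [IsProbabilityMeasure ρ]
    {f : Λ → X → ℝ} (hf : ∀ a, Measurable (f a)) {A B K δ : ℝ} (hA : ∀ a x, A ≤ f a x)
    (hB : ∀ a x, f a x ≤ B) (hK : B - A ≤ K) (hK0 : 0 < K) (hδ : 0 ≤ δ) {n : ℕ} (hn : 0 < n)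
    (hlarge : Real.exp (-(2 * δ ^ 2 * n / K ^ 2)) ≤ 1 / 2)
    (hS : AEMeasurable (fun x : Fin (n + n) → X => ⨆ a, ∑ k, splitWeights n k * f a (x k))
      (Measure.pi fun _ => ρ))
    (hN : AEMeasurable (fun x : Fin (n + n) → X => (numSeparations f (Set.Icc A B) x : ℝ))
      (Measure.pi fun _ => ρ)) :
    (Measure.pi fun _ : Fin n => ρ)
        {x | ∃ a, 2 * δ < ∫ y, f a y ∂ρ - 1 / (n : ℝ) * ∑ i, f a (x i)} ≤
      2 * ENNReal.ofReal (Real.exp (-(δ ^ 2 * n / (2 * K ^ 2))) *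
        Real.exp (annealedEntropy ρ f (Set.Icc A B) (n + n))) := by
  set S := {x : Fin (n + n) → X | δ < ⨆ a, ∑ k, splitWeights n k * f a (x k)} with hSdef
  -- S is only null measurable, while the ghost-sample argument takes sections at every point. A
  -- measurable hull of equal measure is used instead.
  have h1 := measure_ghost_le ρ (measurableSet_toMeasurable (Measure.pi fun _ => ρ) S)
  rw [measure_toMeasurable] at h1
  refine (measure_mono ?_).trans (h1.trans ?_)
  · rintro x ⟨a, ha⟩
    refine (half_le_measure_ghost ρ (hf a) (hA a) (hB a) hK hK0 hδ hn hlarge ha).trans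
      (measure_mono fun y hy => subset_toMeasurable _ _ ?_)
    exact lt_of_lt_of_le hy (le_ciSup (bddAbove_weighted hA hB _ _) a)
  · gcongr
    exact measure_split_le ρ hA hB hK hK0 hδ hn hS hN

/-- One-sided deviation of the data means, uniformly over a large set of subjects. -/
lemma exists_good_subjects [Nonempty Λ] (μ : Measure Z) (ν : Measure T)
    [IsProbabilityMeasure μ] [IsProbabilityMeasure ν] {Q : Z → T → Λ → ℝ}
    (hQ : ∀ a, Measurable fun p : Z × T => Q p.1 p.2 a)
    (hsup : ∀ (n : ℕ) (w : Fin n → ℝ),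
      AEMeasurable (fun p : (Fin n → Z) × T => ⨆ a, ∑ i, w i * Q (p.1 i) p.2 a)
        ((Measure.pi fun _ : Fin n => μ).prod ν))
    {A B K δ : ℝ} (hA : ∀ z t a, A ≤ Q z t a) (hB : ∀ z t a, Q z t a ≤ B)
    (hK : B - A ≤ K) (hK0 : 0 < K) (hδ : 0 < δ)
    (hN : ∀ᵐ t ∂ν, ∀ l, AEMeasurable
      (fun z : Fin l → Z => (numSeparations (fun a z => Q z t a) (Set.Icc A B) z : ℝ))
      (Measure.pi fun _ : Fin l => μ))
    (hH : ∀ᵐ t ∂ν, Tendsto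
      (fun l : ℕ => annealedEntropy μ (fun a z => Q z t a) (Set.Icc A B) l / l) atTop (𝓝 0))
    {q : ℝ} (hq : 0 < q) :
    ∃ G : Set T, MeasurableSet G ∧ ν Gᶜ ≤ ENNReal.ofReal q ∧ ∃ L : ℕ, ∀ l, L ≤ l →
      ((Measure.pi fun _ : Fin l => μ).prod ν)
        {p | p.2 ∈ G ∧ ∃ a, 2 * δ < localRisk μ Q a p.2 -
          1 / (l : ℝ) * ∑ i, Q (p.1 i) p.2 a} ≤
      2 * ENNReal.ofReal (Real.exp (-(δ ^ 2 / (4 * K ^ 2) * l))) := by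
  set S : ∀ l : ℕ, Set ((Fin (l + l) → Z) × T) := fun l =>
    {p | δ < ⨆ a, ∑ k, splitWeights l k * Q (p.1 k) p.2 a} with hS
  set S' : ∀ l : ℕ, Set ((Fin (l + l) → Z) × T) := fun l =>
    toMeasurable ((Measure.pi fun _ => μ).prod ν) (S l) with hS'
  have hS'm : ∀ l, MeasurableSet (S' l) := fun l => measurableSet_toMeasurable _ _
  set p : ℕ → T → ENNReal := fun l t =>
    (Measure.pi fun _ : Fin (l + l) => μ) ((fun z => (z, t)) ⁻¹' S' l) with hp
  have hpm : ∀ l, Measurable (p l) := fun l => measurable_measure_prodMk_right (hS'm l)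
  set c : ℝ := δ ^ 2 / (4 * K ^ 2) with hc
  have hc0 : 0 < c := by positivity
  have hsec : ∀ᵐ t ∂ν, ∀ l : ℕ, AEMeasurable
      (fun z : Fin (l + l) → Z => ⨆ a, ∑ k, splitWeights l k * Q (z k) t a)
      (Measure.pi fun _ => μ) := by
    refine ae_all_iff.2 fun l => ?_
    have h := (hsup (l + l) (splitWeights l)).prod_swap.aestronglyMeasurable.prodMk_left
    filter_upwards [h] with t ht using ht.aemeasurable
  -- The hull is taken once in the product, so that its section measures are measurable in t. By
  -- Fubini they agree with those of the original event for almost every t.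
  have heq : ∀ᵐ t ∂ν, ∀ l : ℕ, p l t =
      (Measure.pi fun _ : Fin (l + l) => μ) ((fun z => (z, t)) ⁻¹' S l) := by
    refine ae_all_iff.2 fun l => ?_
    have h1 : NullMeasurableSet (S l) ((Measure.pi fun _ => μ).prod ν) :=
      nullMeasurableSet_lt aemeasurable_const (hsup _ _)
    have h2 := h1.toMeasurable_ae_eq
    have h3 := Measure.ae_ae_of_ae_prod
      (Measure.measurePreserving_swap.quasiMeasurePreserving.ae h2)
    filter_upwards [h3] with t ht
    exact measure_congr ht
  have hlarge : ∀ᶠ l : ℕ in atTop, Real.exp (-(2 * δ ^ 2 * l / K ^ 2)) ≤ 1 / 2 := by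
    filter_upwards [eventually_exp_neg_le_half (c := 2 * δ ^ 2 / K ^ 2) (by positivity)] with l hl
    rwa [mul_div_right_comm]
  -- Subjects whose exponential bound is in force from L on. These sets increase to a set of full
  -- measure, so some G L has complement of measure at most q.
  set G : ℕ → Set T := fun L =>
    {t | ∀ l, L ≤ l → p l t ≤ ENNReal.ofReal (Real.exp (-(c * l)))} with hG
  have hGm : ∀ L, MeasurableSet (G L) := fun L => by
    simp only [hG, Set.ofPred_forall]
    exact MeasurableSet.iInter fun l => MeasurableSet.iInter fun _ =>
      measurableSet_le (hpm l) measurable_const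
  have hGae : ∀ᵐ t ∂ν, ∃ L, t ∈ G L := by
    filter_upwards [hsec, heq, hN, hH] with t h1 h2 h3 h4
    obtain ⟨L, hL⟩ := eventually_atTop.1 (eventually_double_le h4 hc0)
    refine ⟨max L 1, fun l hl => ?_⟩
    rw [h2]
    refine (measure_split_le μ (fun a z => hA z t a) (fun a z => hB z t a) hK hK0 hδ.le
      (le_of_max_le_right hl) (h1 l) (h3 _)).trans (ENNReal.ofReal_le_ofReal ?_)
    rw [← Real.exp_add, Real.exp_le_exp]
    have h5 := hL l (le_of_max_le_left hl)
    -- The available exponent is twice c: one half pays for the entropy and the other remains as the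
    -- rate.
    have h6 : δ ^ 2 * l / (2 * K ^ 2) = 2 * (c * l) := by
      rw [hc]; field_simp; ring
    rw [h6]
    linarith
  have hGt : Tendsto (fun L => ν (G L)ᶜ) atTop (𝓝 0) := by
    have hanti : Antitone fun L => (G L)ᶜ := by
      intro L L' hLL
      exact Set.compl_subset_compl.2 fun t ht l hl => ht l (hLL.trans hl)
    have h := tendsto_measure_iInter_atTop (μ := ν)
      (fun L => (hGm L).compl.nullMeasurableSet) hanti ⟨0, measure_ne_top _ _⟩
    have h0 : ν (⋂ L, (G L)ᶜ) = 0 := by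
      rw [← Set.compl_iUnion]
      refine measure_mono_null ?_ (ae_iff.1 hGae)
      intro t ht
      simpa using ht
    rwa [h0] at h
  obtain ⟨L₁, hL₁⟩ := (hGt.eventually_le_const (ENNReal.ofReal_pos.2 hq)).exists
  obtain ⟨L₂, hL₂⟩ := eventually_atTop.1 hlarge
  refine ⟨G L₁, hGm L₁, hL₁, max (max L₁ L₂) 1, fun l hl => ?_⟩
  have hl1 : L₁ ≤ l := (le_max_left _ _).trans (le_of_max_le_left hl)
  have hl2 : L₂ ≤ l := (le_max_right _ _).trans (le_of_max_le_left hl)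
  have hl0 : 0 < l := le_of_max_le_right hl
  set R : Set (((Fin l → Z) × T) × (Fin l → Z)) :=
    {r | (Fin.append r.1.1 r.2, r.1.2) ∈ S' l} with hR
  have hRm : MeasurableSet R := by
    have h : Measurable fun r : ((Fin l → Z) × T) × (Fin l → Z) =>
        (Fin.append r.1.1 r.2, r.1.2) :=
      (measurable_append.comp (measurable_fst.fst.prodMk measurable_snd)).prodMk
        measurable_fst.snd
    exact h (hS'm l)
  -- A measurable cover of the deviation event, so that the product measure can be computed by
  -- integrating over t. The ghost sample consists of data only, with the subject held fixed.
  set E : Set ((Fin l → Z) × T) :=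
    {r | r.2 ∈ G L₁ ∧ 1 / 2 ≤ (Measure.pi fun _ : Fin l => μ) (Prod.mk r ⁻¹' R)} with hE
  have hEm : MeasurableSet E :=
    (measurable_snd (hGm L₁)).inter
      (measurableSet_le measurable_const (measurable_measure_prodMk_left hRm))
  have hsub : {p : (Fin l → Z) × T | p.2 ∈ G L₁ ∧ ∃ a, 2 * δ < localRisk μ Q a p.2 -
      1 / (l : ℝ) * ∑ i, Q (p.1 i) p.2 a} ⊆ E := by
    rintro ⟨z, t⟩ ⟨ht, a, ha⟩
    refine ⟨ht, ?_⟩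
    refine (half_le_measure_ghost μ (g := fun z => Q z t a)
      ((hQ a).comp (measurable_id.prodMk measurable_const)) (fun z => hA z t a)
      (fun z => hB z t a) hK hK0 hδ.le hl0 (hL₂ l hl2) ha).trans
      (measure_mono fun y hy => subset_toMeasurable _ _ ?_)
    exact lt_of_lt_of_le hy (le_ciSup (bddAbove_weighted (f := fun a z => Q z t a)
      (fun a z => hA z t a) (fun a z => hB z t a) _ _) a)
  refine (measure_mono hsub).trans ?_
  rw [Measure.prod_apply_symm hEm]
  refine (lintegral_mono (g := fun _ => 2 * ENNReal.ofReal (Real.exp (-(c * l))))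
    fun t => ?_).trans_eq (by simp)
  by_cases ht : t ∈ G L₁
  · refine le_trans (le_trans (measure_mono fun z hz => ?_)
      (measure_ghost_le μ (measurable_prodMk_right (hS'm l) :
        MeasurableSet ((fun z => (z, t)) ⁻¹' S' l)))) ?_
    · exact hz.2
    · exact mul_le_mul_right (ht l hl1) 2
  · have : (fun z => (z, t)) ⁻¹' E = ∅ := by
      ext z
      simp [hE, ht]
    simp [this]

end OneSidedBounds

/-! ### Combining the deviations over subjects and over data. -/

section Combination

variable {Z T Λ Ω : Type*}

lemma abs_mean_le {n : ℕ} {y : ℕ → ℝ} {b : ℝ} (hb : 0 ≤ b) (hy : ∀ i, |y i| ≤ b) :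
    |1 / (n : ℝ) * ∑ i ∈ Finset.range n, y i| ≤ b := by
  rcases Nat.eq_zero_or_pos n with rfl | hn
  · simpa using hb
  have hn' : (0 : ℝ) < n := by exact_mod_cast hn
  rw [abs_mul, abs_of_pos (by positivity), one_div, ← div_eq_inv_mul, div_le_iff₀ hn']
  refine (Finset.abs_sum_le_sum_abs _ _).trans ((Finset.sum_le_sum fun i _ => hy i).trans_eq ?_)
  simp [mul_comm]

/-- If few subjects are bad, then the mean gap is small. -/
lemma mean_le_of_few_bad {m : ℕ} (hm : 0 < m) {t : Fin m → T} {G : Set T} {D : Fin m → ℝ}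
    {K ε : ℝ} (hK : 0 < K) (hD : ∀ j, D j ≤ K) (hε : 0 < ε) (hG : ∀ j, t j ∈ G → D j ≤ ε / 4)
    (hbad : ∑ j, (Gᶜ).indicator (1 : T → ℝ) (t j) ≤ ε / (4 * K) * m) :
    1 / (m : ℝ) * ∑ j, D j ≤ ε / 2 := by
  have hm' : (0 : ℝ) < m := by exact_mod_cast hm
  have h1 : ∀ j, D j ≤ ε / 4 + K * (Gᶜ).indicator (1 : T → ℝ) (t j) := by
    intro j
    by_cases hj : t j ∈ G
    · simpa [hj] using hG j hj
    · rw [Set.indicator_of_mem (Set.mem_compl hj), Pi.one_apply]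
      linarith [hD j]
  have h2 : ∑ j, D j ≤ m * (ε / 4) + K * (ε / (4 * K) * m) := by
    refine (Finset.sum_le_sum fun j _ => h1 j).trans ?_
    rw [Finset.sum_add_distrib, ← Finset.mul_sum]
    simp only [Finset.sum_const, Finset.card_univ, Fintype.card_fin, nsmul_eq_mul]
    gcongr
  have h3 : K * (ε / (4 * K) * m) = m * (ε / 4) := by field_simp
  rw [one_div, ← div_eq_inv_mul, div_le_iff₀ hm']
  linarith

variable [MeasurableSpace Z] [MeasurableSpace T]

/-- The risk gap splits into the gap over subjects and the mean of the gaps over data. -/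
lemma globalRisk_sub_empRisk (μ : Measure Z) (ν : Measure T) (Q : Z → T → Λ → ℝ)
    (zs : ℕ → Ω → Z) (ts : ℕ → Ω → T) (m l : ℕ) (a : Λ) (ω : Ω) :
    globalRisk μ ν Q a - empRisk Q zs ts m l a ω =
      (∫ t, localRisk μ Q a t ∂ν - 1 / (m : ℝ) * ∑ j : Fin m, localRisk μ Q a (ts j ω)) +
      1 / (m : ℝ) * ∑ j : Fin m, (localRisk μ Q a (ts j ω) -
        1 / (l : ℝ) * ∑ i : Fin l, Q (zs i ω) (ts j ω) a) := by
  rw [Finset.sum_sub_distrib, mul_sub, globalRisk, empRisk,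
    Finset.sum_range (n := m)]
  simp only [Finset.sum_range (n := l), localRisk]
  ring

variable [MeasurableSpace Ω]

lemma hasLaw_sample {X : Type*} [MeasurableSpace X] {ρ : Measure X} {P : Measure Ω}
    [IsProbabilityMeasure P] {xs : ℕ → Ω → X} (h : ∀ i, HasLaw (xs i) ρ P)
    (hi : iIndepFun xs P) (n : ℕ) :
    HasLaw (fun ω (i : Fin n) => xs i ω) (Measure.pi fun _ : Fin n => ρ) P :=
  (hi.precomp (Fin.val_injective (n := n))).hasLaw_pi (μ := fun _ => ρ) fun i => h i

/-- The subjects are all evaluated on the same data. One subject together with the data has a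
product law, which is all that a union bound over subjects requires. -/
lemma hasLaw_sample_pair {μ : Measure Z} {ν : Measure T} {P : Measure Ω}
    [IsProbabilityMeasure P] {zs : ℕ → Ω → Z} {ts : ℕ → Ω → T}
    (hz : ∀ i, HasLaw (zs i) μ P) (ht : ∀ j, HasLaw (ts j) ν P) (hzi : iIndepFun zs P)
    (hzt : IndepFun (fun ω i => zs i ω) (fun ω j => ts j ω) P) (l j : ℕ) :
    HasLaw (fun ω => (fun i : Fin l => zs i ω, ts j ω))
      ((Measure.pi fun _ : Fin l => μ).prod ν) P := by
  have h : IndepFun (fun ω (i : Fin l) => zs i ω) (ts j) P :=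
    hzt.comp (φ := fun (z : ℕ → Z) (i : Fin l) => z i) (ψ := fun t : ℕ → T => t j)
      (by fun_prop) (by fun_prop)
  exact h.hasLaw_prod (hasLaw_sample hz hzi l) (ht j)

/-- For an arbitrary set only this inequality is available. It suffices for events that quantify
over an arbitrary Λ and may fail to be measurable. -/
lemma measure_preimage_le_of_hasLaw {X : Type*} [MeasurableSpace X] {ρ : Measure X}
    {P : Measure Ω} {x : Ω → X} (h : HasLaw x ρ P) (s : Set X) : P {ω | x ω ∈ s} ≤ ρ s := by
  rw [← h.map_eq]
  exact Measure.le_map_apply h.aemeasurable s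

/-- Union bound over the subjects. -/
lemma measure_exists_subject_le {μ : Measure Z} {ν : Measure T} {P : Measure Ω}
    [IsProbabilityMeasure P] {zs : ℕ → Ω → Z} {ts : ℕ → Ω → T}
    (hz : ∀ i, HasLaw (zs i) μ P) (ht : ∀ j, HasLaw (ts j) ν P) (hzi : iIndepFun zs P)
    (hzt : IndepFun (fun ω i => zs i ω) (fun ω j => ts j ω) P) (m l : ℕ)
    (E : Set ((Fin l → Z) × T)) :
    P {ω | ∃ j : Fin m, (fun i : Fin l => zs i ω, ts j ω) ∈ E} ≤
      m * ((Measure.pi fun _ : Fin l => μ).prod ν) E := by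
  rw [Set.ofPred_exists]
  refine (measure_iUnion_fintype_le P _).trans ?_
  refine (Finset.sum_le_sum fun (j : Fin m) _ =>
    measure_preimage_le_of_hasLaw (hasLaw_sample_pair hz ht hzi hzt l j) E).trans_eq ?_
  simp

lemma measurable_localRisk {μ : Measure Z} [IsProbabilityMeasure μ] {Q : Z → T → Λ → ℝ} {a : Λ}
    (hQ : Measurable fun p : Z × T => Q p.1 p.2 a) : Measurable (localRisk μ Q a) := by
  have h : StronglyMeasurable fun p : T × Z => Q p.2 p.1 a :=
    (hQ.comp measurable_swap).stronglyMeasurable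
  exact h.integral_prod_right.measurable

/-- The probability of a one-sided deviation for large samples. -/
lemma exists_measure_oneSidedProcess_le [Nonempty Λ] {μ : Measure Z} {ν : Measure T}
    {P : Measure Ω} [IsProbabilityMeasure μ] [IsProbabilityMeasure ν] [IsProbabilityMeasure P]
    {Q : Z → T → Λ → ℝ} {zs : ℕ → Ω → Z} {ts : ℕ → Ω → T}
    (hz : ∀ i, HasLaw (zs i) μ P) (ht : ∀ j, HasLaw (ts j) ν P)
    (hzi : iIndepFun zs P) (hti : iIndepFun ts P)
    (hzt : IndepFun (fun ω i => zs i ω) (fun ω j => ts j ω) P)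
    (hQ : IsMeasurableSet μ ν Q) {Az Bz At Bt K : ℝ}
    (hzb : ∀ z t a, Az ≤ Q z t a ∧ Q z t a ≤ Bz)
    (htb : ∀ t a, At ≤ localRisk μ Q a t ∧ localRisk μ Q a t ≤ Bt)
    (hKz : Bz - Az ≤ K) (hKt : Bt - At ≤ K) (hK : 0 < K)
    (hNz : ∀ᵐ t ∂ν, ∀ l, AEMeasurable
      (fun z : Fin l → Z => (dataSeparations Q t z : ℝ)) (Measure.pi fun _ : Fin l => μ))
    (hNt : ∀ m, AEMeasurable
      (fun t : Fin m → T => (subjectSeparations μ Q t : ℝ)) (Measure.pi fun _ : Fin m => ν))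
    (hHz : ∀ᵐ t ∂ν, Tendsto (fun l : ℕ => dataEntropy μ Q t l / l) atTop (𝓝 0))
    (hHt : Tendsto (fun m : ℕ => subjectEntropy μ ν Q m / m) atTop (𝓝 0))
    {ε : ℝ} (hε : 0 < ε) :
    ∃ M : ℕ, ∀ m l, M ≤ m → M ≤ l →
      P {ω | ε < oneSidedProcess μ ν Q zs ts m l ω} ≤
        ENNReal.ofReal (2 * Real.exp (-(ε ^ 2 / (64 * K ^ 2) * m)) +
          Real.exp (-(ε ^ 2 / (32 * K ^ 2) * m)) +
          m * (2 * Real.exp (-(ε ^ 2 / (256 * K ^ 2) * l)))) := by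
  obtain ⟨a₀⟩ := ‹Nonempty Λ›
  have : Nonempty Λ := ⟨a₀⟩
  obtain ⟨z₀⟩ : Nonempty Z := nonempty_of_isProbabilityMeasure μ
  obtain ⟨t₀⟩ : Nonempty T := nonempty_of_isProbabilityMeasure ν
  -- the admissible thresholds
  set A₁ := ⨅ p : Z × T × Λ, Q p.1 p.2.1 p.2.2 with hA₁
  set B₁ := ⨆ p : Z × T × Λ, Q p.1 p.2.1 p.2.2 with hB₁
  set A₂ := ⨅ p : Λ × T, localRisk μ Q p.1 p.2 with hA₂
  set B₂ := ⨆ p : Λ × T, localRisk μ Q p.1 p.2 with hB₂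
  have : Nonempty (Z × T × Λ) := ⟨(z₀, t₀, a₀)⟩
  have : Nonempty (Λ × T) := ⟨(a₀, t₀)⟩
  have hA1 : ∀ z t a, A₁ ≤ Q z t a := fun z t a =>
    ciInf_le (f := fun p : Z × T × Λ => Q p.1 p.2.1 p.2.2)
      ⟨Az, by rintro _ ⟨p, rfl⟩; exact (hzb _ _ _).1⟩ (z, t, a)
  have hB1 : ∀ z t a, Q z t a ≤ B₁ := fun z t a =>
    le_ciSup (f := fun p : Z × T × Λ => Q p.1 p.2.1 p.2.2)
      ⟨Bz, by rintro _ ⟨p, rfl⟩; exact (hzb _ _ _).2⟩ (z, t, a)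
  have hA2 : ∀ a t, A₂ ≤ localRisk μ Q a t := fun a t =>
    ciInf_le (f := fun p : Λ × T => localRisk μ Q p.1 p.2)
      ⟨At, by rintro _ ⟨p, rfl⟩; exact (htb _ _).1⟩ (a, t)
  have hB2 : ∀ a t, localRisk μ Q a t ≤ B₂ := fun a t =>
    le_ciSup (f := fun p : Λ × T => localRisk μ Q p.1 p.2)
      ⟨Bt, by rintro _ ⟨p, rfl⟩; exact (htb _ _).2⟩ (a, t)
  have hK1 : B₁ - A₁ ≤ K := by
    have h1 : Az ≤ A₁ := le_ciInf fun p => (hzb _ _ _).1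
    have h2 : B₁ ≤ Bz := ciSup_le fun p => (hzb _ _ _).2
    linarith
  have hK2 : B₂ - A₂ ≤ K := by
    have h1 : At ≤ A₂ := le_ciInf fun p => (htb _ _).1
    have h2 : B₂ ≤ Bt := ciSup_le fun p => (htb _ _).2
    linarith
  have hmeas : ∀ a, Measurable (localRisk μ Q a) := fun a => measurable_localRisk (hQ.measurable a)
  -- a large set of good subjects
  obtain ⟨G, hGm, hGν, L, hL⟩ := exists_good_subjects μ ν hQ.measurable hQ.sup_data hA1 hB1 hK1 hK
    (δ := ε / 8) (by positivity) hNz hHz (q := ε / (8 * K)) (by positivity)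
  have hlarge : ∀ᶠ m : ℕ in atTop, Real.exp (-(2 * (ε / 4) ^ 2 * m / K ^ 2)) ≤ 1 / 2 := by
    filter_upwards [eventually_exp_neg_le_half (c := 2 * (ε / 4) ^ 2 / K ^ 2) (by positivity)]
      with m hm
    rwa [mul_div_right_comm]
  obtain ⟨M, hM⟩ := eventually_atTop.1 (hlarge.and
    (eventually_double_le hHt (η := ε ^ 2 / (64 * K ^ 2)) (by positivity)))
  refine ⟨max (max L M) 1, fun m l hm hl => ?_⟩
  have hm0 : 0 < m := le_of_max_le_right hm
  have hl0 : 0 < l := le_of_max_le_right hl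
  have hlL : L ≤ l := (le_max_left _ _).trans (le_of_max_le_left hl)
  obtain ⟨hM1, hM2⟩ := hM m ((le_max_right _ _).trans (le_of_max_le_left hm))
  have hm' : (0 : ℝ) < m := by exact_mod_cast hm0
  -- The budget: off E₁ the gap over subjects is at most ε/2. Off E₂ the fraction of bad subjects is
  -- at most ε/(4K), half from their probability and half from fluctuation. Off E₃ every good
  -- subject has data gap at most ε/4. The last two together contribute at most another ε/2.
  set E₁ : Set (Fin m → T) := {t | ∃ a, 2 * (ε / 4) <
    ∫ y, localRisk μ Q a y ∂ν - 1 / (m : ℝ) * ∑ j, localRisk μ Q a (t j)} with hE₁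
  set E₂ : Set (Fin m → T) := {t | ε / (8 * K) * m ≤
    ∑ j, ((Gᶜ).indicator (1 : T → ℝ) (t j) - ∫ y, (Gᶜ).indicator (1 : T → ℝ) y ∂ν)} with hE₂
  set E₃ : Set ((Fin l → Z) × T) := {p | p.2 ∈ G ∧ ∃ a, 2 * (ε / 8) < localRisk μ Q a p.2 -
    1 / (l : ℝ) * ∑ i, Q (p.1 i) p.2 a} with hE₃
  have hsub : {ω | ε < oneSidedProcess μ ν Q zs ts m l ω} ⊆
      ({ω | (fun j : Fin m => ts j ω) ∈ E₁} ∪ {ω | (fun j : Fin m => ts j ω) ∈ E₂}) ∪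
        {ω | ∃ j : Fin m, (fun i : Fin l => zs i ω, ts j ω) ∈ E₃} := by
    intro ω hω
    by_contra hcon
    simp only [Set.mem_union, not_or] at hcon
    obtain ⟨⟨h1, h2⟩, h3⟩ := hcon
    obtain ⟨a, ha⟩ := exists_lt_of_lt_ciSup (show ε < ⨆ a, _ from hω)
    rw [globalRisk_sub_empRisk] at ha
    have h1' : ∫ y, localRisk μ Q a y ∂ν - 1 / (m : ℝ) * ∑ j : Fin m, localRisk μ Q a (ts j ω) ≤
        2 * (ε / 4) := not_lt.1 fun h => h1 ⟨a, h⟩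
    have h2' : ∑ j : Fin m, (Gᶜ).indicator (1 : T → ℝ) (ts j ω) ≤ ε / (4 * K) * m := by
      have h := (not_le.1 fun h : ε / (8 * K) * m ≤ ∑ j : Fin m,
        ((Gᶜ).indicator (1 : T → ℝ) (ts j ω) - ∫ y, (Gᶜ).indicator (1 : T → ℝ) y ∂ν) => h2 h).le
      rw [Finset.sum_sub_distrib, integral_indicator_one hGm.compl] at h
      simp only [Finset.sum_const, Finset.card_univ, Fintype.card_fin, nsmul_eq_mul] at h
      have h4 : ν.real Gᶜ ≤ ε / (8 * K) :=
        ENNReal.toReal_le_of_le_ofReal (by positivity) hGν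
      have h5 : ε / (4 * K) = ε / (8 * K) + ε / (8 * K) := by field_simp; norm_num
      have h6 := mul_le_mul_of_nonneg_left h4 hm'.le
      rw [h5]
      linarith
    have h3' := mean_le_of_few_bad hm0 (t := fun j : Fin m => ts j ω) (G := G)
      (D := fun j : Fin m => localRisk μ Q a (ts j ω) -
        1 / (l : ℝ) * ∑ i : Fin l, Q (zs i ω) (ts j ω) a) hK (ε := ε) ?_ hε ?_ h2'
    · linarith
    · intro j
      have hl' : (0 : ℝ) < l := by exact_mod_cast hl0
      have h4 : localRisk μ Q a (ts j ω) ≤ Bz := by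
        have h5 : ∫ z, Q z (ts j ω) a ∂μ ≤ ∫ _, Bz ∂μ := by
          refine integral_mono (Integrable.of_mem_Icc Az Bz ?_
            (ae_of_all _ fun z => hzb z _ a)) (integrable_const _) fun z => (hzb z _ a).2
          exact ((hQ.measurable a).comp (measurable_id.prodMk measurable_const)).aemeasurable
        simpa [localRisk] using h5
      have h5 : Az ≤ 1 / (l : ℝ) * ∑ i : Fin l, Q (zs i ω) (ts j ω) a := by
        rw [one_div, ← div_eq_inv_mul, le_div_iff₀ hl']
        refine le_trans (le_of_eq ?_) (Finset.sum_le_sum fun i _ => (hzb _ _ _).1)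
        simp [mul_comm]
      linarith
    · intro j hj
      have h := not_lt.1 fun h => h3 ⟨j, hj, a, h⟩
      simp only at h
      linarith
  have hP1 : P {ω | (fun j : Fin m => ts j ω) ∈ E₁} ≤
      ENNReal.ofReal (2 * Real.exp (-(ε ^ 2 / (64 * K ^ 2) * m))) := by
    refine (measure_preimage_le_of_hasLaw (hasLaw_sample ht hti m) E₁).trans ?_
    refine (measure_deviation_le ν hmeas hA2 hB2 hK2 hK (by positivity) hm0 hM1
      (hQ.sup_subject _ _) (hNt _)).trans ?_
    rw [ENNReal.ofReal_mul two_pos.le, ENNReal.ofReal_ofNat, ← Real.exp_add]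
    gcongr
    -- Half of this exponent absorbs the entropy of the doubled subject sample.
    have h6 : (ε / 4) ^ 2 * m / (2 * K ^ 2) = 2 * (ε ^ 2 / (64 * K ^ 2) * m) := by
      field_simp; norm_num
    have h7 : annealedEntropy ν (localRisk μ Q) (Set.Icc A₂ B₂) (m + m) ≤
      ε ^ 2 / (64 * K ^ 2) * m := hM2
    rw [h6]
    linarith
  have hP2 : P {ω | (fun j : Fin m => ts j ω) ∈ E₂} ≤
      ENNReal.ofReal (Real.exp (-(ε ^ 2 / (32 * K ^ 2) * m))) := by
    refine (measure_preimage_le_of_hasLaw (hasLaw_sample ht hti m) E₂).trans ?_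
    refine (pi_hoeffding ν (measurable_one.indicator hGm.compl) (A := 0) (B := 1) (K := 1)
      (fun x => Set.indicator_nonneg (fun _ _ => zero_le_one) x)
      (fun x => Set.indicator_le_self' (fun _ _ => zero_le_one) x) (by norm_num) one_pos
      (by positivity) m).trans_eq ?_
    congr 3
    field_simp
    norm_num
  have hP3 : P {ω | ∃ j : Fin m, (fun i : Fin l => zs i ω, ts j ω) ∈ E₃} ≤
      ENNReal.ofReal (m * (2 * Real.exp (-(ε ^ 2 / (256 * K ^ 2) * l)))) := by
    refine (measure_exists_subject_le hz ht hzi hzt m l E₃).trans ?_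
    rw [ENNReal.ofReal_mul (by positivity), ENNReal.ofReal_natCast,
      ENNReal.ofReal_mul (by norm_num), ENNReal.ofReal_ofNat]
    gcongr
    refine (hL l hlL).trans_eq ?_
    congr 4
    field_simp
    norm_num
  rw [ENNReal.ofReal_add (by positivity) (by positivity),
    ENNReal.ofReal_add (by positivity) (by positivity)]
  refine (measure_mono hsub).trans ((measure_union_le _ _).trans ?_)
  exact add_le_add ((measure_union_le _ _).trans (add_le_add hP1 hP2)) hP3

/-- The upper deviation of the empirical global risk for a fixed parameter. -/
lemma measure_empRisk_sub_le {μ : Measure Z} {ν : Measure T} {P : Measure Ω}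
    [IsProbabilityMeasure μ] [IsProbabilityMeasure ν] [IsProbabilityMeasure P]
    {Q : Z → T → Λ → ℝ} {zs : ℕ → Ω → Z} {ts : ℕ → Ω → T}
    (hz : ∀ i, HasLaw (zs i) μ P) (ht : ∀ j, HasLaw (ts j) ν P)
    (hzi : iIndepFun zs P) (hti : iIndepFun ts P)
    (hzt : IndepFun (fun ω i => zs i ω) (fun ω j => ts j ω) P)
    {a : Λ} (hQ : Measurable fun p : Z × T => Q p.1 p.2 a) {Az Bz At Bt K : ℝ}
    (hzb : ∀ z t, Az ≤ Q z t a ∧ Q z t a ≤ Bz)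
    (htb : ∀ t, At ≤ localRisk μ Q a t ∧ localRisk μ Q a t ≤ Bt)
    (hKz : Bz - Az ≤ K) (hKt : Bt - At ≤ K) (hK : 0 < K) {ε : ℝ} (hε : 0 < ε) {m l : ℕ}
    (hm : 0 < m) (hl : 0 < l) :
    P {ω | ε < empRisk Q zs ts m l a ω - globalRisk μ ν Q a} ≤
      ENNReal.ofReal (Real.exp (-(ε ^ 2 / (2 * K ^ 2) * m)) +
        m * Real.exp (-(ε ^ 2 / (2 * K ^ 2) * l))) := by
  have hm' : (0 : ℝ) < m := by exact_mod_cast hm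
  have hl' : (0 : ℝ) < l := by exact_mod_cast hl
  -- For a fixed parameter Hoeffding applies directly to subjects and to data, each with allowance
  -- ε/2.
  set E₁ : Set (Fin m → T) := {t | ε / 2 * m ≤
    ∑ j, (localRisk μ Q a (t j) - ∫ y, localRisk μ Q a y ∂ν)} with hE₁
  set E₂ : Set ((Fin l → Z) × T) := {p | ε / 2 * l ≤
    ∑ i, (Q (p.1 i) p.2 a - localRisk μ Q a p.2)} with hE₂
  have hloc : Measurable (localRisk μ Q a) := measurable_localRisk hQ
  have hsub : {ω | ε < empRisk Q zs ts m l a ω - globalRisk μ ν Q a} ⊆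
      {ω | (fun j : Fin m => ts j ω) ∈ E₁} ∪
        {ω | ∃ j : Fin m, (fun i : Fin l => zs i ω, ts j ω) ∈ E₂} := by
    intro ω hω
    by_contra hcon
    simp only [Set.mem_union, not_or] at hcon
    obtain ⟨h1, h2⟩ := hcon
    have hω' : globalRisk μ ν Q a - empRisk Q zs ts m l a ω < -ε := by
      have : ε < empRisk Q zs ts m l a ω - globalRisk μ ν Q a := hω
      linarith
    rw [globalRisk_sub_empRisk] at hω'
    have h1' : 1 / (m : ℝ) * ∑ j : Fin m, localRisk μ Q a (ts j ω) -
        ∫ y, localRisk μ Q a y ∂ν ≤ ε / 2 := by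
      have h := (not_le.1 fun h : ε / 2 * m ≤ ∑ j : Fin m,
        (localRisk μ Q a (ts j ω) - ∫ y, localRisk μ Q a y ∂ν) => h1 h).le
      simp only [Finset.sum_sub_distrib, Finset.sum_const, Finset.card_univ, Fintype.card_fin,
        nsmul_eq_mul] at h
      rw [one_div, ← div_eq_inv_mul, sub_le_iff_le_add, div_le_iff₀ hm']
      linarith
    have h2' : -(ε / 2) ≤ 1 / (m : ℝ) * ∑ j : Fin m, (localRisk μ Q a (ts j ω) -
        1 / (l : ℝ) * ∑ i : Fin l, Q (zs i ω) (ts j ω) a) := by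
      rw [one_div, ← div_eq_inv_mul, le_div_iff₀ hm']
      refine le_trans (le_of_eq ?_) (Finset.sum_le_sum (f := fun _ : Fin m => -(ε / 2))
        fun j _ => ?_)
      · simp [mul_comm]
      · have h := (not_le.1 fun h : ε / 2 * l ≤ ∑ i : Fin l,
          (Q (zs i ω) (ts j ω) a - localRisk μ Q a (ts j ω)) => h2 ⟨j, h⟩).le
        simp only [Finset.sum_sub_distrib, Finset.sum_const, Finset.card_univ, Fintype.card_fin,
          nsmul_eq_mul] at h
        have h3 : 1 / (l : ℝ) * ∑ i : Fin l, Q (zs i ω) (ts j ω) a ≤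
            localRisk μ Q a (ts j ω) + ε / 2 := by
          rw [one_div, ← div_eq_inv_mul, div_le_iff₀ hl']
          linarith
        linarith
    linarith
  have hP1 : P {ω | (fun j : Fin m => ts j ω) ∈ E₁} ≤
      ENNReal.ofReal (Real.exp (-(ε ^ 2 / (2 * K ^ 2) * m))) := by
    refine (measure_preimage_le_of_hasLaw (hasLaw_sample ht hti m) E₁).trans ?_
    refine (pi_hoeffding ν hloc (fun t => (htb t).1) (fun t => (htb t).2) hKt hK
      (by positivity) m).trans_eq ?_
    congr 3
    field_simp
  have hE₂m : MeasurableSet E₂ := by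
    refine measurableSet_le measurable_const (Finset.measurable_sum _ fun i _ => ?_)
    refine Measurable.sub ?_ (hloc.comp measurable_snd)
    exact hQ.comp (f := fun p : (Fin l → Z) × T => (p.1 i, p.2))
      (((measurable_pi_apply i).comp measurable_fst).prodMk measurable_snd)
  have hP2 : P {ω | ∃ j : Fin m, (fun i : Fin l => zs i ω, ts j ω) ∈ E₂} ≤
      ENNReal.ofReal (m * Real.exp (-(ε ^ 2 / (2 * K ^ 2) * l))) := by
    refine (measure_exists_subject_le hz ht hzi hzt m l E₂).trans ?_
    rw [ENNReal.ofReal_mul (by positivity), ENNReal.ofReal_natCast]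
    gcongr
    rw [Measure.prod_apply_symm hE₂m]
    refine (lintegral_mono (g := fun _ => ENNReal.ofReal
      (Real.exp (-(ε ^ 2 / (2 * K ^ 2) * l)))) fun t => ?_).trans_eq (by simp)
    refine (pi_hoeffding μ (g := fun z => Q z t a)
      (hQ.comp (measurable_id.prodMk measurable_const))
      (fun z => (hzb z t).1) (fun z => (hzb z t).2) hKz hK (by positivity) l).trans_eq ?_
    congr 3
    field_simp
  rw [ENNReal.ofReal_add (by positivity) (by positivity)]
  exact (measure_mono hsub).trans ((measure_union_le _ _).trans (add_le_add hP1 hP2))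

end Combination

/-! ### Consequences of the sample-size rule. -/

section Rule

variable {Az Bz At Bt ε₀ : ℝ}

lemma SampleRule.pos {m l : ℕ} (h : SampleRule Az Bz At Bt ε₀ m l) : 0 < l := by
  have h0 : (0 : ℝ) ≤ 2 * (Bz - Az) ^ 2 / ε₀ ^ 2 * Real.log m +
      (Bz - Az) ^ 2 / (Bt - At) ^ 2 * m :=
    add_nonneg (mul_nonneg (by positivity) (Real.log_natCast_nonneg m)) (by positivity)
  exact_mod_cast lt_of_le_of_lt h0 h

/-- The logarithmic term is nonnegative, also at m = 0 where `Real.log 0 = 0`, and can be dropped.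
The asymptotic estimates rest on the linear term. -/
lemma SampleRule.mul_lt {m l : ℕ} (h : SampleRule Az Bz At Bt ε₀ m l) :
    (Bz - Az) ^ 2 / (Bt - At) ^ 2 * m < l := by
  have h0 : (0 : ℝ) ≤ 2 * (Bz - Az) ^ 2 / ε₀ ^ 2 * Real.log m :=
    mul_nonneg (by positivity) (Real.log_natCast_nonneg m)
  have h1 : _ < (l : ℝ) := h
  linarith

/-- Under the sample-size relation `l` grows at least linearly in `m`. -/
lemma eventually_forall_sampleRule (hz : Az < Bz) (ht : At < Bt) {p : ℕ → Prop}
    (hp : ∀ᶠ l in atTop, p l) :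
    ∀ᶠ m in atTop, ∀ l, SampleRule Az Bz At Bt ε₀ m l → p l := by
  have hκ : 0 < (Bz - Az) ^ 2 / (Bt - At) ^ 2 := by
    have := sub_pos.2 hz
    have := sub_pos.2 ht
    positivity
  obtain ⟨L, hL⟩ := eventually_atTop.1 hp
  have h : Tendsto (fun m : ℕ => (Bz - Az) ^ 2 / (Bt - At) ^ 2 * (m : ℝ)) atTop atTop :=
    tendsto_natCast_atTop_atTop.const_mul_atTop hκ
  filter_upwards [h.eventually_ge_atTop (L : ℝ)] with m hm l hl
  refine hL l ?_
  exact_mod_cast (hm.trans hl.mul_lt.le)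

/-- Under the sample-size relation `m` is negligible against any exponential in `l`. -/
lemma eventually_mul_exp_le (hz : Az < Bz) (ht : At < Bt) {c η : ℝ} (hc : 0 < c) (hη : 0 < η) :
    ∀ᶠ m : ℕ in atTop, ∀ l : ℕ, SampleRule Az Bz At Bt ε₀ m l →
      m * Real.exp (-(c * l)) ≤ η := by
  have hκ : 0 < (Bz - Az) ^ 2 / (Bt - At) ^ 2 := by
    have := sub_pos.2 hz
    have := sub_pos.2 ht
    positivity
  set κ := (Bz - Az) ^ 2 / (Bt - At) ^ 2 with hκdef
  -- Since κm < l under the rule, it suffices that l e^{-cl} tends to 0.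
  have h1 : Tendsto (fun l : ℕ => (l : ℝ) * Real.exp (-(c * l))) atTop (𝓝 0) := by
    have h := (Real.tendsto_pow_mul_exp_neg_atTop_nhds_zero 1).comp
      ((tendsto_natCast_atTop_atTop (R := ℝ)).const_mul_atTop hc)
    have h2 := h.const_mul (1 / c)
    rw [mul_zero] at h2
    refine h2.congr fun l => ?_
    simp only [Function.comp_apply, pow_one]
    field_simp
  filter_upwards [eventually_forall_sampleRule (ε₀ := ε₀) hz ht
    (h1.eventually_le_const (u := κ * η) (by positivity))] with m hm l hl
  have h2 := hm l hl
  have h3 := mul_le_mul_of_nonneg_right hl.mul_lt.le (Real.exp_pos (-(c * l))).le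
  have h4 : κ * (m * Real.exp (-(c * l))) ≤ κ * η := by
    rw [← mul_assoc]
    exact h3.trans h2
  exact le_of_mul_le_mul_left h4 hκ

lemma tendsto_fst_sampleFilter :
    Tendsto Prod.fst (sampleFilter Az Bz At Bt ε₀) atTop :=
  (tendsto_fst.mono_left prod_atTop_atTop_eq.ge).mono_left inf_le_left

lemma tendsto_snd_sampleFilter :
    Tendsto Prod.snd (sampleFilter Az Bz At Bt ε₀) atTop :=
  (tendsto_snd.mono_left prod_atTop_atTop_eq.ge).mono_left inf_le_left

lemma eventually_sampleRule :
    ∀ᶠ p in sampleFilter Az Bz At Bt ε₀, SampleRule Az Bz At Bt ε₀ p.1 p.2 :=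
  mem_inf_of_right (mem_principal_self _)

lemma tendsto_exp_neg_mul {ι : Type*} {F : Filter ι} {u : ι → ℕ} (hu : Tendsto u F atTop)
    {c : ℝ} (hc : 0 < c) : Tendsto (fun p => Real.exp (-(c * u p))) F (𝓝 0) :=
  Real.tendsto_exp_neg_atTop_nhds_zero.comp
    (((tendsto_natCast_atTop_atTop (R := ℝ)).comp hu).const_mul_atTop hc)

end Rule

/-! ### From one-sided convergence to strict consistency. -/

section Consistency

variable {Z T Λ Ω : Type*}

lemma abs_empRisk_le {Q : Z → T → Λ → ℝ} {b : ℝ} (hb0 : 0 ≤ b) {a : Λ}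
    (hb : ∀ z t, |Q z t a| ≤ b) (zs : ℕ → Ω → Z) (ts : ℕ → Ω → T) (m l : ℕ) (ω : Ω) :
    |empRisk Q zs ts m l a ω| ≤ b :=
  abs_mean_le hb0 fun _ => abs_mean_le hb0 fun _ => hb _ _

variable [MeasurableSpace Z] [MeasurableSpace T]

/-- A constant loss has no deviation at all. -/
lemma globalRisk_eq_empRisk_of_const {μ : Measure Z} {ν : Measure T} [IsProbabilityMeasure μ]
    [IsProbabilityMeasure ν] {Q : Z → T → Λ → ℝ} {A : ℝ} {a : Λ} (hA : ∀ z t, Q z t a = A)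
    (zs : ℕ → Ω → Z) (ts : ℕ → Ω → T) {m l : ℕ} (hm : 0 < m) (hl : 0 < l) (ω : Ω) :
    globalRisk μ ν Q a = empRisk Q zs ts m l a ω := by
  have hm' : (m : ℝ) ≠ 0 := by exact_mod_cast hm.ne'
  have hl' : (l : ℝ) ≠ 0 := by exact_mod_cast hl.ne'
  simp [globalRisk, empRisk, hA, hm', hl']

variable [MeasurableSpace Ω]

lemma abs_globalRisk_le {μ : Measure Z} {ν : Measure T} [IsProbabilityMeasure μ]
    [IsProbabilityMeasure ν] {Q : Z → T → Λ → ℝ} {b : ℝ} {a : Λ} (hb : ∀ z t, |Q z t a| ≤ b) :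
    |globalRisk μ ν Q a| ≤ b := by
  have h1 : ∀ t, ‖∫ z, Q z t a ∂μ‖ ≤ b := fun t => by
    simpa using norm_integral_le_of_norm_le_const (μ := μ) (f := fun z => Q z t a) (C := b)
      (ae_of_all _ fun z => hb z t)
  simpa [globalRisk] using norm_integral_le_of_norm_le_const (μ := ν) (ae_of_all _ h1)

/-- One-sided uniform convergence together with the law of large numbers for every single
parameter gives strict consistency. -/
lemma strictlyConsistent_of_oneSided {P : Measure Ω} {μ : Measure Z} {ν : Measure T}
    [IsProbabilityMeasure μ] [IsProbabilityMeasure ν] {Q : Z → T → Λ → ℝ} {zs : ℕ → Ω → Z}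
    {ts : ℕ → Ω → T} {F : Filter (ℕ × ℕ)} {b : ℝ} (hb0 : 0 ≤ b) (hb : ∀ z t a, |Q z t a| ≤ b)
    (h : OneSidedUniformConvergence P μ ν Q zs ts F)
    (hpt : ∀ a, ∀ ε : ℝ, 0 < ε → Tendsto (fun p : ℕ × ℕ =>
      P {ω | ε < empRisk Q zs ts p.1 p.2 a ω - globalRisk μ ν Q a}) F (𝓝 0)) :
    StrictlyConsistent P μ ν Q zs ts F := by
  intro c hc
  have : Nonempty (riskSuperlevel μ ν Q c) := hc.to_subtype
  rw [tendstoInMeasure_iff_dist]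
  intro ε hε
  have hR : ∀ a, |globalRisk μ ν Q a| ≤ b := fun a => abs_globalRisk_le fun z t => hb z t a
  have hE : ∀ m l a ω, |empRisk Q zs ts m l a ω| ≤ b := fun m l a ω =>
    abs_empRisk_le hb0 (fun z t => hb z t a) zs ts m l ω
  -- A near-minimizer of the true risk, chosen independently of the sample. Its empirical risk
  -- bounds the empirical infimum from above, while the one-sided process bounds it from below.
  obtain ⟨a₀, ha₀⟩ := exists_lt_of_ciInf_lt
    (f := fun a : riskSuperlevel μ ν Q c => globalRisk μ ν Q a)
    (lt_add_of_pos_right _ (show 0 < ε / 4 by positivity))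
  set I := ⨅ a : riskSuperlevel μ ν Q c, globalRisk μ ν Q a with hI
  have hsum := (h (ε / 4) (by positivity)).add (hpt a₀ (ε / 4) (by positivity))
  rw [add_zero] at hsum
  refine tendsto_of_tendsto_of_tendsto_of_le_of_le tendsto_const_nhds hsum
    (fun _ => zero_le) fun p => ?_
  refine (measure_mono ?_).trans (measure_union_le _ _)
  intro ω hω
  by_contra hcon
  simp only [Set.mem_union, not_or] at hcon
  have h1 : oneSidedProcess μ ν Q zs ts p.1 p.2 ω ≤ ε / 4 := not_lt.1 fun h => hcon.1 h
  have h2 : empRisk Q zs ts p.1 p.2 a₀ ω - globalRisk μ ν Q a₀ ≤ ε / 4 :=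
    not_lt.1 fun h => hcon.2 h
  have hup : ⨅ a : riskSuperlevel μ ν Q c, empRisk Q zs ts p.1 p.2 a ω ≤
      empRisk Q zs ts p.1 p.2 a₀ ω :=
    ciInf_le (f := fun a : riskSuperlevel μ ν Q c => empRisk Q zs ts p.1 p.2 a ω)
      ⟨-b, by rintro _ ⟨a, rfl⟩; exact (abs_le.1 (hE _ _ _ _)).1⟩ a₀
  have hlow : I - ε / 4 ≤ ⨅ a : riskSuperlevel μ ν Q c, empRisk Q zs ts p.1 p.2 a ω := by
    refine le_ciInf fun a => ?_
    have h3 : globalRisk μ ν Q a - empRisk Q zs ts p.1 p.2 a ω ≤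
        oneSidedProcess μ ν Q zs ts p.1 p.2 ω := by
      refine le_ciSup (f := fun a => globalRisk μ ν Q a - empRisk Q zs ts p.1 p.2 a ω)
        ⟨b + b, ?_⟩ (a : Λ)
      rintro _ ⟨a, rfl⟩
      have h4 := (abs_le.1 (hR a)).2
      have h5 := (abs_le.1 (hE p.1 p.2 a ω)).1
      simp only
      linarith
    have h6 : I ≤ globalRisk μ ν Q a :=
      ciInf_le (f := fun a : riskSuperlevel μ ν Q c => globalRisk μ ν Q a)
        ⟨-b, by rintro _ ⟨a, rfl⟩; exact (abs_le.1 (hR _)).1⟩ a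
    linarith
  have hd : ε ≤ dist (⨅ a : riskSuperlevel μ ν Q c, empRisk Q zs ts p.1 p.2 a ω) I := hω
  rw [Real.dist_eq] at hd
  have : |(⨅ a : riskSuperlevel μ ν Q c, empRisk Q zs ts p.1 p.2 a ω) - I| < ε := by
    rw [abs_lt]
    constructor <;> linarith
  linarith

end Consistency

end SubjectivityLearning

end

/-! ### Choice of constants and conclusion. -/

theorem mainTheorem5 (Az Bz At Bt ε₀ : ℝ) (hAB : At < Bt) (hε₀ : 0 < ε₀) :
    ∃ rate : ℝ → ℝ, (∀ ε, 0 < ε → 0 < rate ε) ∧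
      ∀ {Z T Λ Ω : Type*} [MeasurableSpace Z] [MeasurableSpace T] [MeasurableSpace Ω]
        (μ : Measure Z) (ν : Measure T) (P : Measure Ω)
        [IsProbabilityMeasure μ] [IsProbabilityMeasure ν] [IsProbabilityMeasure P]
        (Q : Z → T → Λ → ℝ) (zs : ℕ → Ω → Z) (ts : ℕ → Ω → T),
        -- independent identically distributed data and subjects
        (∀ i, HasLaw (zs i) μ P) → (∀ j, HasLaw (ts j) ν P) →
        iIndepFun zs P → iIndepFun ts P →
        IndepFun (fun ω i => zs i ω) (fun ω j => ts j ω) P →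
        -- a measurable set of bounded functions
        SubjectivityLearning.IsMeasurableSet μ ν Q →
        (∀ z t a, Az ≤ Q z t a ∧ Q z t a ≤ Bz) →
        (∀ t a, At ≤ SubjectivityLearning.localRisk μ Q a t ∧
          SubjectivityLearning.localRisk μ Q a t ≤ Bt) →
        -- the numbers of separations are measurable
        (∀ᵐ t ∂ν, ∀ l, AEMeasurable
          (fun z : Fin l → Z => (SubjectivityLearning.dataSeparations Q t z : ℝ))
          (Measure.pi fun _ : Fin l => μ)) →
        (∀ m, AEMeasurable
          (fun t : Fin m → T => (SubjectivityLearning.subjectSeparations μ Q t : ℝ))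
          (Measure.pi fun _ : Fin m => ν)) →
        -- the two entropy conditions
        (∀ᵐ t ∂ν, Tendsto (fun l : ℕ => SubjectivityLearning.dataEntropy μ Q t l / l)
          atTop (𝓝 0)) →
        Tendsto (fun m : ℕ => SubjectivityLearning.subjectEntropy μ ν Q m / m) atTop (𝓝 0) →
        -- nontrivial exponential bounds
        (∀ ε, 0 < ε → ∃ M : ℕ, ∀ m l : ℕ, M ≤ m →
          SubjectivityLearning.SampleRule Az Bz At Bt ε₀ m l →
          P.real {ω | ε < SubjectivityLearning.oneSidedProcess μ ν Q zs ts m l ω} ≤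
            4 * Real.exp (-(rate ε * m)) + 4 * Real.exp (-(rate ε * l))) ∧
        SubjectivityLearning.OneSidedUniformConvergence P μ ν Q zs ts
          (SubjectivityLearning.sampleFilter Az Bz At Bt ε₀) ∧
        SubjectivityLearning.StrictlyConsistent P μ ν Q zs ts
          (SubjectivityLearning.sampleFilter Az Bz At Bt ε₀) := by
  -- A common bound for both ranges, kept positive by the 1. It is fixed before the spaces and laws,
  -- so the rate depends on the bounds alone.
  set K : ℝ := |Bz - Az| + |Bt - At| + 1 with hKdef
  have hK : 0 < K := by positivity
  have hKz : Bz - Az ≤ K := by linarith [le_abs_self (Bz - Az), abs_nonneg (Bt - At)]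
  have hKt : Bt - At ≤ K := by linarith [le_abs_self (Bt - At), abs_nonneg (Bz - Az)]
  refine ⟨fun ε => ε ^ 2 / (512 * K ^ 2), fun ε hε => by positivity, ?_⟩
  intro Z T Λ Ω _ _ _ μ ν P _ _ _ Q zs ts hz ht hzi hti hzt hQ hzb htb hNz hNt hHz hHt
  have hconst : Bz ≤ Az → ∀ a z t, Q z t a = Az := fun h a z t =>
    le_antisymm ((hzb z t a).2.trans h) (hzb z t a).1
  have hexp : ∀ ε, 0 < ε → ∃ M : ℕ, ∀ m l : ℕ, M ≤ m →
      SubjectivityLearning.SampleRule Az Bz At Bt ε₀ m l →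
      P {ω | ε < SubjectivityLearning.oneSidedProcess μ ν Q zs ts m l ω} ≤
        ENNReal.ofReal (4 * Real.exp (-(ε ^ 2 / (512 * K ^ 2) * m)) +
          4 * Real.exp (-(ε ^ 2 / (512 * K ^ 2) * l))) := by
    intro ε hε
    rcases isEmpty_or_nonempty Λ with hΛ | hΛ
    · refine ⟨0, fun m l _ _ => ?_⟩
      simp [SubjectivityLearning.oneSidedProcess, hε.not_gt]
    -- If Bz ≤ Az the linear coefficient of (∗) need not be positive, so growth of l cannot be used.
    -- The loss is then constant and the process vanishes as soon as m and l are positive.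
    rcases le_or_gt Bz Az with hBA | hAB'
    · refine ⟨1, fun m l hm hl => ?_⟩
      have h0 : ∀ ω, SubjectivityLearning.oneSidedProcess μ ν Q zs ts m l ω = 0 := fun ω => by
        simp [SubjectivityLearning.oneSidedProcess,
          fun a => SubjectivityLearning.globalRisk_eq_empRisk_of_const (μ := μ) (ν := ν)
            (hconst hBA a) zs ts hm hl.pos ω]
      simp [h0, hε.not_gt]
    set r : ℝ := ε ^ 2 / (512 * K ^ 2) with hr
    have hr0 : 0 < r := by positivity
    obtain ⟨M, hM⟩ := SubjectivityLearning.exists_measure_oneSidedProcess_le hz ht hzi hti hzt hQ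
      hzb htb hKz hKt hK hNz hNt hHz hHt hε
    obtain ⟨M', hM'⟩ := eventually_atTop.1
      ((SubjectivityLearning.eventually_forall_sampleRule (ε₀ := ε₀) hAB' hAB
        (eventually_ge_atTop M)).and
        (SubjectivityLearning.eventually_mul_exp_le (ε₀ := ε₀) hAB' hAB hr0 one_pos))
    refine ⟨max M M', fun m l hm hl => ?_⟩
    obtain ⟨h1, h2⟩ := hM' m (le_of_max_le_right hm)
    refine (hM m l (le_of_max_le_left hm) (h1 l hl)).trans (ENNReal.ofReal_le_ofReal ?_)
    have e1 : Real.exp (-(ε ^ 2 / (64 * K ^ 2) * m)) ≤ Real.exp (-(r * m)) := by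
      rw [hr]; gcongr; norm_num
    have e2 : Real.exp (-(ε ^ 2 / (32 * K ^ 2) * m)) ≤ Real.exp (-(r * m)) := by
      rw [hr]; gcongr; norm_num
    -- The constant 512 is twice 256: one of the two equal factors absorbs the m of the union bound,
    -- the other gives the stated rate in l.
    have e3 : Real.exp (-(ε ^ 2 / (256 * K ^ 2) * l)) =
        Real.exp (-(r * l)) * Real.exp (-(r * l)) := by
      rw [← Real.exp_add, hr]
      congr 1
      field_simp
      ring
    have e4 := mul_le_mul_of_nonneg_right (h2 l hl) (Real.exp_pos (-(r * l))).le
    have e5 := Real.exp_pos (-(r * m))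
    have e6 := Real.exp_pos (-(r * l))
    rw [e3]
    linarith
  have hone : SubjectivityLearning.OneSidedUniformConvergence P μ ν Q zs ts
      (SubjectivityLearning.sampleFilter Az Bz At Bt ε₀) := by
    intro ε hε
    obtain ⟨M, hM⟩ := hexp ε hε
    have hr0 : 0 < ε ^ 2 / (512 * K ^ 2) := by positivity
    have hlim := ENNReal.tendsto_ofReal
      (((SubjectivityLearning.tendsto_exp_neg_mul
        (SubjectivityLearning.tendsto_fst_sampleFilter (Az := Az) (Bz := Bz) (At := At)
          (Bt := Bt) (ε₀ := ε₀)) hr0).const_mul 4).add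
      ((SubjectivityLearning.tendsto_exp_neg_mul
        SubjectivityLearning.tendsto_snd_sampleFilter hr0).const_mul 4))
    rw [mul_zero, add_zero, ENNReal.ofReal_zero] at hlim
    refine tendsto_of_tendsto_of_tendsto_of_le_of_le' tendsto_const_nhds hlim
      (Eventually.of_forall fun _ => zero_le) ?_
    filter_upwards [SubjectivityLearning.tendsto_fst_sampleFilter.eventually_ge_atTop M,
      SubjectivityLearning.eventually_sampleRule] with p hp1 hp2
    exact hM p.1 p.2 hp1 hp2
  refine ⟨fun ε hε => ?_, hone, ?_⟩
  · obtain ⟨M, hM⟩ := hexp ε hε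
    exact ⟨M, fun m l hm hl => ENNReal.toReal_le_of_le_ofReal (by positivity) (hM m l hm hl)⟩
  · refine SubjectivityLearning.strictlyConsistent_of_oneSided (b := |Az| + |Bz|) (by positivity)
      (fun z t a => ?_) hone fun a ε hε => ?_
    · rw [abs_le]
      constructor
      · linarith [(hzb z t a).1, neg_abs_le Az, abs_nonneg Bz]
      · linarith [(hzb z t a).2, le_abs_self Bz, abs_nonneg Az]
    rcases le_or_gt Bz Az with hBA | hAB'
    · refine tendsto_const_nhds.congr' ?_
      filter_upwards [SubjectivityLearning.tendsto_fst_sampleFilter.eventually_gt_atTop 0,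
        SubjectivityLearning.tendsto_snd_sampleFilter.eventually_gt_atTop 0] with p hp1 hp2
      have h0 : ∀ ω, ¬ε < SubjectivityLearning.empRisk Q zs ts p.1 p.2 a ω -
          SubjectivityLearning.globalRisk μ ν Q a := fun ω => by
        rw [SubjectivityLearning.globalRisk_eq_empRisk_of_const (hconst hBA a) zs ts hp1 hp2 ω,
          sub_self]
        exact hε.not_gt
      simp [h0]
    have hc0 : 0 < ε ^ 2 / (2 * K ^ 2) := by positivity
    have hmul : Tendsto (fun p : ℕ × ℕ => (p.1 : ℝ) * Real.exp (-(ε ^ 2 / (2 * K ^ 2) * p.2)))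
        (SubjectivityLearning.sampleFilter Az Bz At Bt ε₀) (𝓝 0) := by
      refine Metric.tendsto_nhds.2 fun η hη => ?_
      filter_upwards [SubjectivityLearning.tendsto_fst_sampleFilter.eventually
        (SubjectivityLearning.eventually_mul_exp_le (ε₀ := ε₀) hAB' hAB hc0 (half_pos hη)),
        SubjectivityLearning.eventually_sampleRule] with p hp1 hp2
      rw [Real.dist_0_eq_abs, abs_of_nonneg (by positivity)]
      exact (hp1 _ hp2).trans_lt (half_lt_self hη)
    have hlim := ENNReal.tendsto_ofReal ((SubjectivityLearning.tendsto_exp_neg_mul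
        SubjectivityLearning.tendsto_fst_sampleFilter hc0).add hmul)
    rw [add_zero, ENNReal.ofReal_zero] at hlim
    refine tendsto_of_tendsto_of_tendsto_of_le_of_le' tendsto_const_nhds hlim
      (Eventually.of_forall fun _ => zero_le) ?_
    filter_upwards [SubjectivityLearning.tendsto_fst_sampleFilter.eventually_gt_atTop 0,
      SubjectivityLearning.tendsto_snd_sampleFilter.eventually_gt_atTop 0] with p hp1 hp2
    exact SubjectivityLearning.measure_empRisk_sub_le hz ht hzi hti hzt (hQ.measurable a)
      (fun z t => hzb z t a) (fun t => htb t a) hKz hKt hK hε hp1 hp2
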